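/- Let $\Omega\subset\mathbb R^n$ be open, $s\in(0,1)$, and let $q:\Omega\to[1,\infty)$, $p:\Omega\times\Omega\to[1,\infty)$ be measurable with $1<\operatorname{ess\,inf} q\le\operatorname{ess\,sup} q<\infty$ and $1<\operatorname{ess\,inf} p\le\operatorname{ess\,sup} p<\infty$. Put $$\rho_1(u)=\int_\Omega|u(x)|^{q(x)}dx,\qquad \rho_2(u)=\int_\Omega\int_\Omega\frac{|u(x)-u(y)|^{p(x,y)}}{|x-y|^{n+s\,p(x,y)}}\,dx\,dy,\qquad \rho(u)=\rho_1(u)+\rho_2(u).$$ Let $W(\Omega)=\mathcal W^{s,q(\cdot),p(\cdot,\cdot)}(\Omega)$ be the space of measurable $u:\Omega\to\mathbb R$ (modulo a.e. equality) with $\rho_1(\lambda u)<\infty$ and $\rho_2(\lambda' u)<\infty$ for some $\lambda,\lambda'>0$, with the norm $\|u\|=\inf\{\lambda>0:\rho_1(u/\lambda)\le1\}+\inf\{\lambda>0:\rho_2(u/\lambda)\le1\}$. Let $\tilde W(\Omega)$ be the closure in $W(\Omega)$ of $W(\Omega)\cap C_c(\overline\Omega)$, where $C_c(\overline\Omega)$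 is the set of continuous functions on $\overline\Omega$ with compact support in $\overline\Omega$. For $O\subset\overline\Omega$ relatively open, let $C(O)=\inf\{\rho(u):u\in\tilde W(\Omega),\ u\ge1\text{ a.e. on }O\cap\Omega\}$ (with $\inf\varnothing=\infty$), and for $E\subset\overline\Omega$ let $C(E)=\inf\{C(O):O\text{ relatively open in }\overline\Omega,\ E\subset O\}$; this is the fractional relative $(s,q(\cdot),p(\cdot,\cdot))$-capacity $C^{s,\Omega}_{q(\cdot),p(\cdot,\cdot)}$. A property holds relatively quasi everywhere (r.q.e.) on $A\subset\overline\Omega$ if it holds on $A\setminus P$ for some $P\subset A$ with $C(P)=0$. A function $v:\overline\Omega\to\mathbb R$ is relatively quasicontinuous if for every $\varepsilon>0$ there is a relatively open $O\subset\overline\Omega$ with $C(O)<\varepsilon$ such that the restriction of $v$ to $\overline\Omega\setminus O$ is continuous. For $A\subset\Omega$ let $\tilde W_0(A)=\tilde{\mathcal W}_0^{s,q(\cdot),p(\cdot,\cdot)}(A)$ be the set of functions $u:A\to\mathbb R$ for which there is a relatively quasicontinuous $v:\overline\Omega\to\mathbb R$ with $v|_\Omega\in\tilde W(\Omega)$,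 $v=u$ a.e. in $A$, and $v=0$ r.q.e. on $\overline\Omega\setminus A$. Functions in $\tilde W_0(A)$ are extended by zero to $\Omega$ and identified when they agree a.e. in $\Omega$. **Theorem.** Let $N\subset\Omega$ be an arbitrary subset. The following assertions are equivalent: 1. $C^{s,\Omega}_{q(\cdot),p(\cdot,\cdot)}(N\cap\Omega)=0$; 2. $N$ is removable for $\tilde{\mathcal W}_0^{s,q(\cdot),p(\cdot,\cdot)}(\Omega)$, that is, $\tilde{\mathcal W}_0^{s,q(\cdot),p(\cdot,\cdot)}(\Omega)=\tilde{\mathcal W}_0^{s,q(\cdot),p(\cdot,\cdot)}(\Omega\setminus N)$. -/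

import Mathlib

open MeasureTheory
open scoped ENNReal

noncomputable section

namespace FracVar

/-- A variable exponent `r` on a measure space: `r` is measurable and
`1 < ess inf r ≤ ess sup r < ∞`. -/
def IsVariableExponent {α : Type*} [MeasurableSpace α] (μ : Measure α) (r : α → ℝ) : Prop :=
  AEMeasurable r μ ∧ ∃ a b : ℝ, 1 < a ∧ ∀ᵐ x ∂μ, a ≤ r x ∧ r x ≤ b

variable {n : ℕ}

/-- The modular `∫_Ω |u(x)|^{q(x)} dx` of `L^{q(.)}(Ω)`. -/
def lebesgueModular (Ω : Set (EuclideanSpace ℝ (Fin n))) (q : EuclideanSpace ℝ (Fin n) → ℝ)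
    (u : EuclideanSpace ℝ (Fin n) → ℝ) : ℝ≥0∞ :=
  ∫⁻ x in Ω, ENNReal.ofReal (|u x| ^ q x)

/-- The Gagliardo modular
`∫_Ω ∫_Ω |u(x) - u(y)|^{p(x,y)} / |x - y|^{n + s p(x,y)} dx dy`, that is, the modular of
`L^{p(.,.)}(Ω × Ω)` at the quotient `|u(x) - u(y)| / |x - y|^{s + n / p(x,y)}`. -/
def gagliardoModular (Ω : Set (EuclideanSpace ℝ (Fin n))) (s : ℝ)
    (p : EuclideanSpace ℝ (Fin n) × EuclideanSpace ℝ (Fin n) → ℝ)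
    (u : EuclideanSpace ℝ (Fin n) → ℝ) : ℝ≥0∞ :=
  ∫⁻ z in Ω ×ˢ Ω, ENNReal.ofReal (|u z.1 - u z.2| ^ p z / ‖z.1 - z.2‖ ^ ((n : ℝ) + s * p z))

/-- The modular `ρ(u)` of the fractional Sobolev space on `Ω`. -/
def sobolevModular (Ω : Set (EuclideanSpace ℝ (Fin n))) (s : ℝ)
    (q : EuclideanSpace ℝ (Fin n) → ℝ)
    (p : EuclideanSpace ℝ (Fin n) × EuclideanSpace ℝ (Fin n) → ℝ)
    (u : EuclideanSpace ℝ (Fin n) → ℝ) : ℝ≥0∞ :=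
  lebesgueModular Ω q u + gagliardoModular Ω s p u

/-- The Luxemburg norm of `L^{q(.)}(Ω)` (infinite if no `l > 0` is admissible). -/
def lebesgueNorm (Ω : Set (EuclideanSpace ℝ (Fin n))) (q : EuclideanSpace ℝ (Fin n) → ℝ)
    (u : EuclideanSpace ℝ (Fin n) → ℝ) : ℝ≥0∞ :=
  ⨅ (l : ℝ) (_ : 0 < l) (_ : lebesgueModular Ω q (fun x => u x / l) ≤ 1), ENNReal.ofReal l

/-- The variable exponent Gagliardo seminorm on `Ω`. -/
def gagliardoSeminorm (Ω : Set (EuclideanSpace ℝ (Fin n))) (s : ℝ)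
    (p : EuclideanSpace ℝ (Fin n) × EuclideanSpace ℝ (Fin n) → ℝ)
    (u : EuclideanSpace ℝ (Fin n) → ℝ) : ℝ≥0∞ :=
  ⨅ (l : ℝ) (_ : 0 < l) (_ : gagliardoModular Ω s p (fun x => u x / l) ≤ 1), ENNReal.ofReal l

/-- The norm of `W^{s,q(.),p(.,.)}(Ω)`. -/
def sobolevNorm (Ω : Set (EuclideanSpace ℝ (Fin n))) (s : ℝ)
    (q : EuclideanSpace ℝ (Fin n) → ℝ)
    (p : EuclideanSpace ℝ (Fin n) × EuclideanSpace ℝ (Fin n) → ℝ)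
    (u : EuclideanSpace ℝ (Fin n) → ℝ) : ℝ≥0∞ :=
  lebesgueNorm Ω q u + gagliardoSeminorm Ω s p u

/-- `u ∈ W^{s,q(.),p(.,.)}(Ω)`: `u` is measurable on `Ω`, belongs to `L^{q(.)}(Ω)`, and its
difference quotient belongs to `L^{p(.,.)}(Ω × Ω)`. Only the values of `u` on `Ω` matter. -/
def MemSobolev (Ω : Set (EuclideanSpace ℝ (Fin n))) (s : ℝ)
    (q : EuclideanSpace ℝ (Fin n) → ℝ)
    (p : EuclideanSpace ℝ (Fin n) × EuclideanSpace ℝ (Fin n) → ℝ)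
    (u : EuclideanSpace ℝ (Fin n) → ℝ) : Prop :=
  AEMeasurable u (volume.restrict Ω) ∧
    (∃ l : ℝ, 0 < l ∧ lebesgueModular Ω q (fun x => l * u x) < ∞) ∧
    (∃ l : ℝ, 0 < l ∧ gagliardoModular Ω s p (fun x => l * u x) < ∞)

/-- `φ` restricts to a continuous function on `closure Ω` with compact support in
`closure Ω`. -/
def IsContCompactSupp (Ω : Set (EuclideanSpace ℝ (Fin n)))
    (φ : EuclideanSpace ℝ (Fin n) → ℝ) : Prop :=
  ContinuousOn φ (closure Ω) ∧
    ∃ K : Set (EuclideanSpace ℝ (Fin n)), IsCompact K ∧ K ⊆ closure Ω ∧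
      ∀ x ∈ closure Ω \ K, φ x = 0

/-- `u ∈ W̃^{s,q(.),p(.,.)}(Ω)`, the closure of `W^{s,q(.),p(.,.)}(Ω) ∩ C_c(closure Ω)` in
`W^{s,q(.),p(.,.)}(Ω)`. -/
def MemSobolevTilde (Ω : Set (EuclideanSpace ℝ (Fin n))) (s : ℝ)
    (q : EuclideanSpace ℝ (Fin n) → ℝ)
    (p : EuclideanSpace ℝ (Fin n) × EuclideanSpace ℝ (Fin n) → ℝ)
    (u : EuclideanSpace ℝ (Fin n) → ℝ) : Prop :=
  MemSobolev Ω s q p u ∧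
    ∀ ε : ℝ≥0∞, 0 < ε → ∃ φ : EuclideanSpace ℝ (Fin n) → ℝ,
      MemSobolev Ω s q p φ ∧ IsContCompactSupp Ω φ ∧
        sobolevNorm Ω s q p (fun x => u x - φ x) < ε

/-- `O` is a relatively open subset of `closure Ω`. -/
def IsRelOpen (Ω O : Set (EuclideanSpace ℝ (Fin n))) : Prop :=
  ∃ U : Set (EuclideanSpace ℝ (Fin n)), IsOpen U ∧ O = closure Ω ∩ U

/-- The relative capacity of a relatively open set `O`: the infimum of `ρ(u)` over all
`u ∈ W̃^{s,q(.),p(.,.)}(Ω)` with `u ≥ 1` a.e. on `O` (elements of that space being functions on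
`Ω`, this means a.e. on `O ∩ Ω`). -/
def openCapacity (Ω : Set (EuclideanSpace ℝ (Fin n))) (s : ℝ)
    (q : EuclideanSpace ℝ (Fin n) → ℝ)
    (p : EuclideanSpace ℝ (Fin n) × EuclideanSpace ℝ (Fin n) → ℝ)
    (O : Set (EuclideanSpace ℝ (Fin n))) : ℝ≥0∞ :=
  ⨅ (u : EuclideanSpace ℝ (Fin n) → ℝ) (_ : MemSobolevTilde Ω s q p u)
    (_ : ∀ᵐ x ∂(volume.restrict Ω), x ∈ O → 1 ≤ u x), sobolevModular Ω s q p u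

/-- The fractional relative `(s,q(.),p(.,.))`-capacity of a set `A ⊆ closure Ω` with respect
to `Ω`. -/
def relCapacity (Ω : Set (EuclideanSpace ℝ (Fin n))) (s : ℝ)
    (q : EuclideanSpace ℝ (Fin n) → ℝ)
    (p : EuclideanSpace ℝ (Fin n) × EuclideanSpace ℝ (Fin n) → ℝ)
    (A : Set (EuclideanSpace ℝ (Fin n))) : ℝ≥0∞ :=
  ⨅ (O : Set (EuclideanSpace ℝ (Fin n))) (_ : IsRelOpen Ω O) (_ : A ⊆ O),
    openCapacity Ω s q p O

/-- A property holds relatively quasi everywhere on `A`: it holds on `A` outside a subset of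
relative capacity zero. -/
def RelQuasiEverywhere (Ω : Set (EuclideanSpace ℝ (Fin n))) (s : ℝ)
    (q : EuclideanSpace ℝ (Fin n) → ℝ)
    (p : EuclideanSpace ℝ (Fin n) × EuclideanSpace ℝ (Fin n) → ℝ)
    (A : Set (EuclideanSpace ℝ (Fin n))) (P : EuclideanSpace ℝ (Fin n) → Prop) : Prop :=
  ∃ Z : Set (EuclideanSpace ℝ (Fin n)), Z ⊆ A ∧ relCapacity Ω s q p Z = 0 ∧
    ∀ x ∈ A \ Z, P x

/-- Relative quasicontinuity of a function on `closure Ω`. -/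
def RelQuasicontinuous (Ω : Set (EuclideanSpace ℝ (Fin n))) (s : ℝ)
    (q : EuclideanSpace ℝ (Fin n) → ℝ)
    (p : EuclideanSpace ℝ (Fin n) × EuclideanSpace ℝ (Fin n) → ℝ)
    (u : EuclideanSpace ℝ (Fin n) → ℝ) : Prop :=
  ∀ ε : ℝ≥0∞, 0 < ε → ∃ O : Set (EuclideanSpace ℝ (Fin n)), IsRelOpen Ω O ∧
    relCapacity Ω s q p O < ε ∧ ContinuousOn u (closure Ω \ O)

/-- For `A ⊆ Ω`, the functions `u : A → ℝ` for which there is a relatively quasicontinuous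
`v ∈ W̃^{s,q(.),p(.,.)}(Ω)` with `v = u` a.e. in `A` and `v = 0` relatively quasi everywhere in
the complement of `A` (in `closure Ω`, where the capacity and `v` live). -/
def zeroTraceFunctions (Ω : Set (EuclideanSpace ℝ (Fin n))) (s : ℝ)
    (q : EuclideanSpace ℝ (Fin n) → ℝ)
    (p : EuclideanSpace ℝ (Fin n) × EuclideanSpace ℝ (Fin n) → ℝ)
    (A : Set (EuclideanSpace ℝ (Fin n))) : Set (A → ℝ) :=
  {u | ∃ v : EuclideanSpace ℝ (Fin n) → ℝ,
    RelQuasicontinuous Ω s q p v ∧ MemSobolevTilde Ω s q p v ∧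
    (∀ᵐ x ∂(volume : Measure (EuclideanSpace ℝ (Fin n))), ∀ h : x ∈ A, v x = u ⟨x, h⟩) ∧
    RelQuasiEverywhere Ω s q p (closure Ω \ A) (fun x => v x = 0)}

/-- The zero trace space `W̃₀^{s,q(.),p(.,.)}(A)` for `A ⊆ Ω`. Functions on `A` are extended by
zero and then identified when they agree a.e. in `Ω`, so that the spaces for different `A` can
be compared. -/
def zeroTraceSpace (Ω : Set (EuclideanSpace ℝ (Fin n))) (s : ℝ)
    (q : EuclideanSpace ℝ (Fin n) → ℝ)
    (p : EuclideanSpace ℝ (Fin n) × EuclideanSpace ℝ (Fin n) → ℝ)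
    (A : Set (EuclideanSpace ℝ (Fin n))) :
    Set (EuclideanSpace ℝ (Fin n) →ₘ[volume.restrict Ω] ℝ) :=
  {f | ∃ u ∈ zeroTraceFunctions Ω s q p A,
    f =ᵐ[volume.restrict Ω] Function.extend (Subtype.val : A → EuclideanSpace ℝ (Fin n)) u 0}

/-- `N` is removable for `W̃₀^{s,q(.),p(.,.)}(Ω)`. -/
def IsRemovable (Ω : Set (EuclideanSpace ℝ (Fin n))) (s : ℝ)
    (q : EuclideanSpace ℝ (Fin n) → ℝ)
    (p : EuclideanSpace ℝ (Fin n) × EuclideanSpace ℝ (Fin n) → ℝ)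
    (N : Set (EuclideanSpace ℝ (Fin n))) : Prop :=
  zeroTraceSpace Ω s q p Ω = zeroTraceSpace Ω s q p (Ω \ N)

end FracVar

end

/-!
# Removable sets for zero trace spaces are the sets of capacity zero

The exponents are bounded, so norm convergence in the Sobolev space is convergence of the modular
`ρ` (`memSobolev_iff`, `memSobolevTilde_iff`) and norms disappear from the argument.

Two facts on capacity carry the proof. A union of two sets of capacity zero has capacity zero
(`relCapacity_union_eq_zero`): if `u` and `v` are admissible for the two sets, `|u| + |v|` is
admissible for the union, and `W̃` is stable under absolute values because `|φ k| → |u|` in modular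
whenever `φ k → u` in modular and a.e. (`tendsto_modular_of_dominated`, `MemSobolevTilde.abs`). And
a quasicontinuous function that agrees a.e. in `Ω` with a continuous one agrees with it r.q.e. on
`closure Ω` (`relCapacity_ne_eq_zero`), as the capacity of a relatively open set ignores null sets.
Since sets of capacity zero are null, the zero trace space of `A` consists of the classes of
quasicontinuous `v ∈ W̃` with `v = 0` r.q.e. on `closure Ω \ A` (`mem_zeroTraceSpace_iff`).

If `N` has capacity zero, vanishing r.q.e. off `Ω` and off `Ω \ N` are the same condition, so `N`
is removable. For the converse a single test function suffices, and no countable exhaustion is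
needed: `φ(x) = min (dist(x, Ωᶜ)) (exp(-|x|))` is continuous, positive exactly on `Ω`, and lies in
`W̃` (`exists_memSobolevTilde_pos`). It is thus in the zero trace space of `Ω`; if `N` is removable,
it has a quasicontinuous representative `v` vanishing r.q.e. on `N`, while `v = φ > 0` r.q.e. on
`Ω`. So `N` lies in the union of two sets of capacity zero.
-/

namespace FracVar

open Filter Topology

/-! ### Weighted modulars with variable exponent -/

section Modular

variable {α : Type*} [MeasurableSpace α] {μ : Measure α} {r w : α → ℝ}

/-- The modular `∫ |f|^r / w dμ` with variable exponent `r` and weight `1 / w`. The Lebesgue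
modular is the case `w = 1`, the Gagliardo modular the case of the difference `u(x) - u(y)` on
`Ω × Ω` with `w(x, y) = |x - y|^{n + s p(x, y)}`. -/
noncomputable def modular (μ : Measure α) (r w f : α → ℝ) : ℝ≥0∞ :=
  ∫⁻ z, ENNReal.ofReal (|f z| ^ r z / w z) ∂μ

/-- The Luxemburg norm attached to `modular`. -/
noncomputable def luxemburg (μ : Measure α) (r w f : α → ℝ) : ℝ≥0∞ :=
  ⨅ (l : ℝ) (_ : 0 < l) (_ : modular μ r w (fun z => f z / l) ≤ 1), ENNReal.ofReal l

lemma aemeasurable_modular_integrand {f : α → ℝ} (hf : AEMeasurable f μ) (hr : AEMeasurable r μ)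
    (hw : AEMeasurable w μ) :
    AEMeasurable (fun z => ENNReal.ofReal (|f z| ^ r z / w z)) μ :=
  ((hf.abs.pow hr).div hw).ennreal_ofReal

lemma modular_zero (hr : ∀ᵐ z ∂μ, 1 ≤ r z) : modular μ r w (fun _ => 0) = 0 := by
  refine (lintegral_congr_ae ?_).trans lintegral_zero
  filter_upwards [hr] with z hz
  simp [Real.zero_rpow (show r z ≠ 0 by linarith)]

lemma modular_mono (hr : ∀ᵐ z ∂μ, 1 ≤ r z) (hw : ∀ z, 0 ≤ w z) {f g : α → ℝ}
    (h : ∀ᵐ z ∂μ, |f z| ≤ |g z|) : modular μ r w f ≤ modular μ r w g := by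
  refine lintegral_mono_ae ?_
  filter_upwards [hr, h] with z hz hfg
  have := hw z
  gcongr

lemma modular_const_mul_le {b : ℝ} (hr : ∀ᵐ z ∂μ, 1 ≤ r z ∧ r z ≤ b) (hw : ∀ z, 0 ≤ w z)
    (f : α → ℝ) (c : ℝ) :
    modular μ r w (fun z => c * f z) ≤
      ENNReal.ofReal ((max 1 |c|) ^ b) * modular μ r w f := by
  rw [modular, modular, ← lintegral_const_mul' _ _ ENNReal.ofReal_ne_top]
  refine lintegral_mono_ae ?_
  filter_upwards [hr] with z hz
  have := hw z
  rw [← ENNReal.ofReal_mul (by positivity), abs_mul,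
    Real.mul_rpow (abs_nonneg _) (abs_nonneg _), mul_div_assoc]
  gcongr
  calc |c| ^ r z ≤ (max 1 |c|) ^ r z :=
        Real.rpow_le_rpow (abs_nonneg _) (le_max_right _ _) (by linarith)
    _ ≤ (max 1 |c|) ^ b := Real.rpow_le_rpow_of_exponent_le (le_max_left _ _) hz.2

lemma modular_const_mul_le_of_abs_le_one (hr : ∀ᵐ z ∂μ, 1 ≤ r z) (hw : ∀ z, 0 ≤ w z)
    (f : α → ℝ) {c : ℝ} (hc : |c| ≤ 1) :
    modular μ r w (fun z => c * f z) ≤ ENNReal.ofReal |c| * modular μ r w f := by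
  rw [modular, modular, ← lintegral_const_mul' _ _ ENNReal.ofReal_ne_top]
  refine lintegral_mono_ae ?_
  filter_upwards [hr] with z hz
  have := hw z
  rw [← ENNReal.ofReal_mul (by positivity), abs_mul,
    Real.mul_rpow (abs_nonneg _) (abs_nonneg _), mul_div_assoc]
  gcongr
  exact Real.rpow_le_self_of_le_one (abs_nonneg _) hc hz

lemma abs_rpow_le_of_abs_le_add {x y t r b : ℝ} (h : |t| ≤ |x| + |y|) (hr : 1 ≤ r) (hb : r ≤ b) :
    |t| ^ r ≤ 2 ^ b * (|x| ^ r + |y| ^ r) := by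
  have h0 : 0 ≤ max |x| |y| := le_max_of_le_left (abs_nonneg _)
  have h1 : |t| ≤ 2 * max |x| |y| := by
    linarith [le_max_left |x| |y|, le_max_right |x| |y|]
  calc |t| ^ r ≤ (2 * max |x| |y|) ^ r :=
        Real.rpow_le_rpow (abs_nonneg _) h1 (by linarith)
    _ = 2 ^ r * (max |x| |y|) ^ r := Real.mul_rpow (by norm_num) h0
    _ ≤ 2 ^ b * (|x| ^ r + |y| ^ r) := by
        have h2 : (2 : ℝ) ^ r ≤ 2 ^ b := Real.rpow_le_rpow_of_exponent_le (by norm_num) hb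
        have hx : 0 ≤ |x| ^ r := by positivity
        have hy : 0 ≤ |y| ^ r := by positivity
        have h3 : (max |x| |y|) ^ r ≤ |x| ^ r + |y| ^ r := by
          rcases max_choice |x| |y| with h | h <;> rw [h] <;> linarith
        gcongr

lemma ofReal_modular_integrand_le {x y t r b w : ℝ} (h : |t| ≤ |x| + |y|) (hr : 1 ≤ r)
    (hb : r ≤ b) (hw : 0 ≤ w) :
    ENNReal.ofReal (|t| ^ r / w) ≤ ENNReal.ofReal (2 ^ b) *
      (ENNReal.ofReal (|x| ^ r / w) + ENNReal.ofReal (|y| ^ r / w)) := by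
  rw [← ENNReal.ofReal_add (by positivity) (by positivity), ← ENNReal.ofReal_mul (by positivity)]
  apply ENNReal.ofReal_le_ofReal
  rw [← add_div, ← mul_div_assoc]
  gcongr
  exact abs_rpow_le_of_abs_le_add h hr hb

lemma modular_le_of_abs_le_add {b : ℝ} (hr : ∀ᵐ z ∂μ, 1 ≤ r z ∧ r z ≤ b) (hw : ∀ z, 0 ≤ w z)
    (hrm : AEMeasurable r μ) (hwm : AEMeasurable w μ) {f g h : α → ℝ} (hg : AEMeasurable g μ)
    (hfgh : ∀ᵐ z ∂μ, |f z| ≤ |g z| + |h z|) :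
    modular μ r w f ≤ ENNReal.ofReal (2 ^ b) * (modular μ r w g + modular μ r w h) := by
  rw [modular, modular, modular,
    ← lintegral_add_left' (aemeasurable_modular_integrand hg hrm hwm),
    ← lintegral_const_mul' _ _ ENNReal.ofReal_ne_top]
  refine lintegral_mono_ae ?_
  filter_upwards [hr, hfgh] with z hz hz'
  exact ofReal_modular_integrand_le hz' hz.1 hz.2 (hw z)

lemma exists_modular_lt_imp_luxemburg_le {b : ℝ} (hr : ∀ᵐ z ∂μ, 1 ≤ r z ∧ r z ≤ b)
    (hw : ∀ z, 0 ≤ w z) {ε : ℝ≥0∞} (hε : 0 < ε) :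
    ∃ δ : ℝ≥0∞, 0 < δ ∧ ∀ f : α → ℝ, modular μ r w f < δ → luxemburg μ r w f ≤ ε := by
  obtain ⟨t, ht0, htε⟩ : ∃ t : ℝ, 0 < t ∧ ENNReal.ofReal t ≤ ε := by
    obtain ⟨t, ht0, htε⟩ := ENNReal.lt_iff_exists_nnreal_btwn.1 hε
    exact ⟨t, by exact_mod_cast ht0, by simpa using htε.le⟩
  have hC : 0 < (max 1 |t⁻¹|) ^ b := by positivity
  refine ⟨(ENNReal.ofReal ((max 1 |t⁻¹|) ^ b))⁻¹, by simp, fun f hf => ?_⟩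
  refine iInf_le_of_le t (iInf_le_of_le ht0 (iInf_le_of_le ?_ htε))
  have := modular_const_mul_le hr hw f t⁻¹
  simp only [div_eq_inv_mul]
  refine this.trans ?_
  calc _ ≤ ENNReal.ofReal ((max 1 |t⁻¹|) ^ b) * (ENNReal.ofReal ((max 1 |t⁻¹|) ^ b))⁻¹ := by
        gcongr
    _ ≤ 1 := ENNReal.mul_inv_le_one _

lemma modular_le_of_luxemburg_lt (hr : ∀ᵐ z ∂μ, 1 ≤ r z) (hw : ∀ z, 0 ≤ w z)
    {f : α → ℝ} {ε : ℝ≥0∞} (hε : ε ≤ 1) (h : luxemburg μ r w f < ε) :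
    modular μ r w f ≤ ε := by
  simp only [luxemburg, iInf_lt_iff] at h
  obtain ⟨l, hl0, hl1, hlε⟩ := h
  have hl : |l| ≤ 1 := by
    rw [abs_of_pos hl0]
    exact ENNReal.ofReal_le_one.1 (hlε.le.trans hε)
  have h1 := modular_const_mul_le_of_abs_le_one hr hw (fun z => f z / l) hl
  have h2 : (fun z => l * (f z / l)) = f := by
    ext z; field_simp
  rw [h2] at h1
  calc _ ≤ ENNReal.ofReal |l| * 1 := h1.trans (by gcongr)
    _ ≤ ε := by rw [mul_one, abs_of_pos hl0]; exact hlε.le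

/-- A generalized dominated convergence theorem: the dominating functions `|g k| + |h|` may vary,
provided that `g k` tends to zero in modular. The excess of the integrand of `f k` over a multiple
of that of `g k` is dominated by a multiple of that of `h`. -/
lemma tendsto_modular_of_dominated {b : ℝ} (hr : ∀ᵐ z ∂μ, 1 ≤ r z ∧ r z ≤ b)
    (hw : ∀ z, 0 ≤ w z) (hrm : AEMeasurable r μ) (hwm : AEMeasurable w μ)
    {f g : ℕ → α → ℝ} {h : α → ℝ}
    (hf : ∀ k, AEMeasurable (f k) μ) (hg : ∀ k, AEMeasurable (g k) μ)
    (hfgh : ∀ k, ∀ᵐ z ∂μ, |f k z| ≤ |g k z| + |h z|)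
    (hlim : ∀ᵐ z ∂μ, Tendsto (fun k => f k z) atTop (𝓝 0))
    (hg0 : Tendsto (fun k => modular μ r w (g k)) atTop (𝓝 0)) (hh : modular μ r w h < ∞) :
    Tendsto (fun k => modular μ r w (f k)) atTop (𝓝 0) := by
  set C : ℝ≥0∞ := ENNReal.ofReal (2 ^ b)
  have hC : C ≠ ∞ := ENNReal.ofReal_ne_top
  set F : ℕ → α → ℝ≥0∞ := fun k z => ENNReal.ofReal (|f k z| ^ r z / w z)
  set G : ℕ → α → ℝ≥0∞ := fun k z => ENNReal.ofReal (|g k z| ^ r z / w z)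
  set H : α → ℝ≥0∞ := fun z => ENNReal.ofReal (|h z| ^ r z / w z)
  have hFm : ∀ k, AEMeasurable (F k) μ := fun k => aemeasurable_modular_integrand (hf k) hrm hwm
  have hGm : ∀ k, AEMeasurable (G k) μ := fun k => aemeasurable_modular_integrand (hg k) hrm hwm
  have hF0 : ∀ᵐ z ∂μ, Tendsto (fun k => F k z) atTop (𝓝 0) := by
    filter_upwards [hr, hlim] with z hz hz'
    have h1 : Tendsto (fun k => |f k z| ^ r z) atTop (𝓝 (|(0 : ℝ)| ^ r z)) :=
      hz'.abs.rpow_const (Or.inr (by linarith))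
    rw [abs_zero, Real.zero_rpow (by linarith)] at h1
    have h2 := ENNReal.tendsto_ofReal (h1.div_const (w z))
    simpa using h2
  have hdom : Tendsto (fun k => ∫⁻ z, (F k z - C * G k z) ∂μ) atTop (𝓝 (∫⁻ _, 0 ∂μ)) := by
    refine tendsto_lintegral_of_dominated_convergence' (fun z => C * H z)
      (fun k => (hFm k).sub ((hGm k).const_mul C)) (fun k => ?_) ?_ ?_
    · filter_upwards [hr, hfgh k] with z hz hz'
      rw [tsub_le_iff_left, ← mul_add]
      exact ofReal_modular_integrand_le hz' hz.1 hz.2 (hw z)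
    · rw [lintegral_const_mul' _ _ hC]
      exact (ENNReal.mul_lt_top hC.lt_top hh).ne
    · filter_upwards [hF0] with z hz
      exact tendsto_of_tendsto_of_tendsto_of_le_of_le tendsto_const_nhds hz
        (fun _ => zero_le) (fun _ => tsub_le_self)
  rw [lintegral_zero] at hdom
  have hsum : Tendsto (fun k => ∫⁻ z, (F k z - C * G k z) ∂μ + C * modular μ r w (g k))
      atTop (𝓝 0) := by
    simpa using hdom.add (ENNReal.Tendsto.const_mul hg0 (Or.inr hC))
  refine tendsto_of_tendsto_of_tendsto_of_le_of_le tendsto_const_nhds hsum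
    (fun _ => zero_le) (fun k => ?_)
  calc modular μ r w (f k) ≤ ∫⁻ z, ((F k z - C * G k z) + C * G k z) ∂μ :=
        lintegral_mono fun z => le_tsub_add
    _ = _ := by
        rw [lintegral_add_right' _ ((hGm k).const_mul C), lintegral_const_mul' _ _ hC]
        rfl

/-- Sequences that tend to zero fast enough in modular tend to zero almost everywhere. -/
lemma ae_tendsto_zero_of_modular_le (hr : ∀ᵐ z ∂μ, 1 ≤ r z) (hrm : AEMeasurable r μ)
    {f : ℕ → α → ℝ} (hf : ∀ k, AEMeasurable (f k) μ)
    (h : ∀ k, modular μ r (fun _ => 1) (f k) ≤ 2⁻¹ ^ k) :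
    ∀ᵐ z ∂μ, Tendsto (fun k => f k z) atTop (𝓝 0) := by
  set F : ℕ → α → ℝ≥0∞ := fun k z => ENNReal.ofReal (|f k z| ^ r z / 1)
  have hFm : ∀ k, AEMeasurable (F k) μ :=
    fun k => aemeasurable_modular_integrand (hf k) hrm aemeasurable_const
  have hsum : ∫⁻ z, ∑' k, F k z ∂μ ≠ ∞ := by
    rw [lintegral_tsum hFm]
    refine ((ENNReal.tsum_le_tsum h).trans_lt ?_).ne
    rw [ENNReal.tsum_geometric, ENNReal.one_sub_inv_two, inv_inv]
    exact ENNReal.ofNat_lt_top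
  filter_upwards [hr, ae_lt_top' (AEMeasurable.tsum hFm) hsum] with z hz hz'
  have h1 := ENNReal.tendsto_atTop_zero_of_tsum_ne_top hz'.ne
  have h2 : Tendsto (fun k => |f k z| ^ r z) atTop (𝓝 0) := by
    have := (ENNReal.tendsto_toReal ENNReal.zero_ne_top).comp h1
    refine this.congr fun k => ?_
    simp only [Function.comp, F, div_one]
    exact ENNReal.toReal_ofReal (by positivity)
  have h3 := h2.rpow_const (p := (r z)⁻¹) (Or.inr (by positivity))
  rw [Real.zero_rpow (inv_ne_zero (by linarith))] at h3
  rw [tendsto_zero_iff_abs_tendsto_zero]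
  refine h3.congr fun k => ?_
  exact Real.rpow_rpow_inv (abs_nonneg _) (by linarith)

end Modular

/-! ### The Sobolev modular and the space `W̃` -/

section

variable {n : ℕ}

lemma IsVariableExponent.exists_bound {α : Type*} [MeasurableSpace α] {μ : Measure α}
    {r : α → ℝ} (h : IsVariableExponent μ r) : ∃ b : ℝ, ∀ᵐ z ∂μ, 1 ≤ r z ∧ r z ≤ b := by
  obtain ⟨-, a, b, ha, hab⟩ := h
  exact ⟨b, hab.mono fun z hz => ⟨by linarith, hz.2⟩⟩

lemma IsVariableExponent.one_le {α : Type*} [MeasurableSpace α] {μ : Measure α}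
    {r : α → ℝ} (h : IsVariableExponent μ r) : ∀ᵐ z ∂μ, 1 ≤ r z := by
  obtain ⟨b, hb⟩ := h.exists_bound
  exact hb.mono fun z hz => hz.1

/-- The difference `u(x) - u(y)` as a function of the pair `(x, y)`. -/
def pairDiff (u : EuclideanSpace ℝ (Fin n) → ℝ) :
    EuclideanSpace ℝ (Fin n) × EuclideanSpace ℝ (Fin n) → ℝ :=
  fun z => u z.1 - u z.2

/-- The weight `|x - y|^{n + s p(x, y)}` of the Gagliardo modular. -/
noncomputable def gagliardoWeight (s : ℝ)
    (p : EuclideanSpace ℝ (Fin n) × EuclideanSpace ℝ (Fin n) → ℝ) :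
    EuclideanSpace ℝ (Fin n) × EuclideanSpace ℝ (Fin n) → ℝ :=
  fun z => ‖z.1 - z.2‖ ^ ((n : ℝ) + s * p z)

variable {Ω : Set (EuclideanSpace ℝ (Fin n))} {s : ℝ} {q : EuclideanSpace ℝ (Fin n) → ℝ}
  {p : EuclideanSpace ℝ (Fin n) × EuclideanSpace ℝ (Fin n) → ℝ}
  {u v φ : EuclideanSpace ℝ (Fin n) → ℝ}

lemma lebesgueModular_eq (u : EuclideanSpace ℝ (Fin n) → ℝ) :
    lebesgueModular Ω q u = modular (volume.restrict Ω) q (fun _ => 1) u := by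
  simp [lebesgueModular, modular]

lemma gagliardoModular_eq (u : EuclideanSpace ℝ (Fin n) → ℝ) :
    gagliardoModular Ω s p u =
      modular (volume.restrict (Ω ×ˢ Ω)) p (gagliardoWeight s p) (pairDiff u) := rfl

lemma lebesgueNorm_eq (u : EuclideanSpace ℝ (Fin n) → ℝ) :
    lebesgueNorm Ω q u = luxemburg (volume.restrict Ω) q (fun _ => 1) u := by
  simp only [lebesgueNorm, luxemburg, lebesgueModular_eq]

lemma pairDiff_div (u : EuclideanSpace ℝ (Fin n) → ℝ) (l : ℝ) :
    pairDiff (fun x => u x / l) = fun z => pairDiff u z / l := by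
  ext z; simp only [pairDiff]; ring

lemma pairDiff_mul (u : EuclideanSpace ℝ (Fin n) → ℝ) (l : ℝ) :
    pairDiff (fun x => l * u x) = fun z => l * pairDiff u z := by
  ext z; simp only [pairDiff]; ring

lemma gagliardoSeminorm_eq (u : EuclideanSpace ℝ (Fin n) → ℝ) :
    gagliardoSeminorm Ω s p u =
      luxemburg (volume.restrict (Ω ×ˢ Ω)) p (gagliardoWeight s p) (pairDiff u) := by
  simp only [gagliardoSeminorm, luxemburg, gagliardoModular_eq, pairDiff_div]

lemma gagliardoWeight_nonneg (z : EuclideanSpace ℝ (Fin n) × EuclideanSpace ℝ (Fin n)) :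
    0 ≤ gagliardoWeight s p z := by
  unfold gagliardoWeight; positivity

lemma aemeasurable_gagliardoWeight
    {μ : Measure (EuclideanSpace ℝ (Fin n) × EuclideanSpace ℝ (Fin n))} (hp : AEMeasurable p μ) :
    AEMeasurable (gagliardoWeight s p) μ :=
  (measurable_fst.sub measurable_snd).norm.aemeasurable.pow ((hp.const_mul s).const_add _)

lemma restrict_prod_self (Ω : Set (EuclideanSpace ℝ (Fin n))) :
    (volume : Measure (EuclideanSpace ℝ (Fin n) × EuclideanSpace ℝ (Fin n))).restrict (Ω ×ˢ Ω) =
      (volume.restrict Ω).prod (volume.restrict Ω) := by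
  rw [Measure.prod_restrict, Measure.volume_eq_prod]

lemma ae_pair_of_ae {P : EuclideanSpace ℝ (Fin n) → Prop}
    (h : ∀ᵐ x ∂(volume.restrict Ω), P x) :
    ∀ᵐ z ∂(volume.restrict (Ω ×ˢ Ω)), P z.1 ∧ P z.2 := by
  rw [restrict_prod_self]
  exact (Measure.quasiMeasurePreserving_fst.ae h).and (Measure.quasiMeasurePreserving_snd.ae h)

lemma aemeasurable_pairDiff (hu : AEMeasurable u (volume.restrict Ω)) :
    AEMeasurable (pairDiff u) (volume.restrict (Ω ×ˢ Ω)) := by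
  rw [restrict_prod_self]
  exact (hu.comp_quasiMeasurePreserving Measure.quasiMeasurePreserving_fst).sub
    (hu.comp_quasiMeasurePreserving Measure.quasiMeasurePreserving_snd)

lemma sobolevModular_zero (hq : IsVariableExponent (volume.restrict Ω) q)
    (hp : IsVariableExponent (volume.restrict (Ω ×ˢ Ω)) p) :
    sobolevModular Ω s q p (fun _ => 0) = 0 := by
  have h : pairDiff (fun _ : EuclideanSpace ℝ (Fin n) => (0 : ℝ)) = fun _ => 0 := by
    ext z; simp [pairDiff]
  rw [sobolevModular, lebesgueModular_eq, gagliardoModular_eq, h, modular_zero hq.one_le,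
    modular_zero hp.one_le, add_zero]

lemma sobolevModular_le_of_abs_le_add (hq : IsVariableExponent (volume.restrict Ω) q)
    (hp : IsVariableExponent (volume.restrict (Ω ×ˢ Ω)) p) :
    ∃ C : ℝ≥0∞, C ≠ ∞ ∧ ∀ f g h : EuclideanSpace ℝ (Fin n) → ℝ,
      AEMeasurable g (volume.restrict Ω) →
      (∀ x, |f x| ≤ |g x| + |h x|) →
      (∀ z, |pairDiff f z| ≤ |pairDiff g z| + |pairDiff h z|) →
      sobolevModular Ω s q p f ≤ C * (sobolevModular Ω s q p g + sobolevModular Ω s q p h) := by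
  obtain ⟨b, hb⟩ := hq.exists_bound
  obtain ⟨b', hb'⟩ := hp.exists_bound
  refine ⟨max (ENNReal.ofReal (2 ^ b)) (ENNReal.ofReal (2 ^ b')), by simp, ?_⟩
  intro f g h hg h1 h2
  simp only [sobolevModular, lebesgueModular_eq, gagliardoModular_eq]
  have e1 := modular_le_of_abs_le_add hb (fun _ => zero_le_one) hq.1 aemeasurable_const hg
    (ae_of_all _ h1)
  have e2 := modular_le_of_abs_le_add hb' (gagliardoWeight_nonneg (s := s)) hp.1
    (aemeasurable_gagliardoWeight hp.1) (aemeasurable_pairDiff hg) (ae_of_all _ h2)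
  refine (add_le_add e1 e2).trans ?_
  rw [add_add_add_comm (modular _ _ _ g), mul_add (max _ _)]
  gcongr
  · exact le_max_left _ _
  · exact le_max_right _ _

lemma sobolevModular_add_le (hq : IsVariableExponent (volume.restrict Ω) q)
    (hp : IsVariableExponent (volume.restrict (Ω ×ˢ Ω)) p) :
    ∃ C : ℝ≥0∞, C ≠ ∞ ∧ ∀ g h : EuclideanSpace ℝ (Fin n) → ℝ,
      AEMeasurable g (volume.restrict Ω) →
      sobolevModular Ω s q p (fun x => g x + h x) ≤
        C * (sobolevModular Ω s q p g + sobolevModular Ω s q p h) := by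
  obtain ⟨C, hC, H⟩ := sobolevModular_le_of_abs_le_add (s := s) hq hp
  refine ⟨C, hC, fun g h hg => H _ g h hg (fun x => abs_add_le _ _) fun z => ?_⟩
  refine le_trans (le_of_eq ?_) (abs_add_le (pairDiff g z) (pairDiff h z))
  simp only [pairDiff]; ring_nf

lemma sobolevModular_abs_le (hq : IsVariableExponent (volume.restrict Ω) q)
    (hp : IsVariableExponent (volume.restrict (Ω ×ˢ Ω)) p) (u : EuclideanSpace ℝ (Fin n) → ℝ) :
    sobolevModular Ω s q p (fun x => |u x|) ≤ sobolevModular Ω s q p u := by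
  simp only [sobolevModular, lebesgueModular_eq, gagliardoModular_eq]
  exact add_le_add
    (modular_mono hq.one_le (fun _ => zero_le_one) (ae_of_all _ fun x => by simp))
    (modular_mono hp.one_le gagliardoWeight_nonneg (ae_of_all _ fun z => abs_abs_sub_abs_le _ _))

/-- Since the exponents are bounded, membership in the Sobolev space amounts to finiteness of the
modular, without scaling. -/
lemma memSobolev_iff (hq : IsVariableExponent (volume.restrict Ω) q)
    (hp : IsVariableExponent (volume.restrict (Ω ×ˢ Ω)) p) :
    MemSobolev Ω s q p u ↔
      AEMeasurable u (volume.restrict Ω) ∧ sobolevModular Ω s q p u < ∞ := by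
  obtain ⟨b, hb⟩ := hq.exists_bound
  obtain ⟨b', hb'⟩ := hp.exists_bound
  simp only [MemSobolev, sobolevModular, ENNReal.add_lt_top]
  refine and_congr_right fun _ => and_congr ⟨?_, fun h => ⟨1, one_pos, by simpa using h⟩⟩
    ⟨?_, fun h => ⟨1, one_pos, by simpa using h⟩⟩
  · rintro ⟨l, hl, h⟩
    rw [lebesgueModular_eq] at h ⊢
    have := modular_const_mul_le hb (fun _ => zero_le_one) (fun x => l * u x) l⁻¹
    simp only [inv_mul_cancel_left₀ hl.ne'] at this
    exact this.trans_lt (ENNReal.mul_lt_top ENNReal.ofReal_lt_top h)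
  · rintro ⟨l, hl, h⟩
    rw [gagliardoModular_eq, pairDiff_mul] at h
    rw [gagliardoModular_eq]
    have := modular_const_mul_le hb' (gagliardoWeight_nonneg (s := s) (p := p))
      (fun x => l * pairDiff u x) l⁻¹
    simp only [inv_mul_cancel_left₀ hl.ne'] at this
    exact this.trans_lt (ENNReal.mul_lt_top ENNReal.ofReal_lt_top h)

lemma exists_sobolevModular_lt_imp_sobolevNorm_lt
    (hq : IsVariableExponent (volume.restrict Ω) q)
    (hp : IsVariableExponent (volume.restrict (Ω ×ˢ Ω)) p) {ε : ℝ≥0∞} (hε : 0 < ε) :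
    ∃ δ : ℝ≥0∞, 0 < δ ∧ ∀ f, sobolevModular Ω s q p f < δ → sobolevNorm Ω s q p f < ε := by
  obtain ⟨η, hη0, hηε⟩ := exists_between hε
  have hη2 : 0 < η / 2 := ENNReal.half_pos hη0.ne'
  obtain ⟨b, hb⟩ := hq.exists_bound
  obtain ⟨b', hb'⟩ := hp.exists_bound
  obtain ⟨δ, hδ, h⟩ := exists_modular_lt_imp_luxemburg_le hb (fun _ => zero_le_one) hη2
  obtain ⟨δ', hδ', h'⟩ := exists_modular_lt_imp_luxemburg_le hb'
    (gagliardoWeight_nonneg (s := s)) hη2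
  refine ⟨min δ δ', lt_min hδ hδ', fun f hf => ?_⟩
  rw [sobolevModular, lebesgueModular_eq, gagliardoModular_eq] at hf
  rw [sobolevNorm, lebesgueNorm_eq, gagliardoSeminorm_eq]
  calc _ ≤ η / 2 + η / 2 :=
        add_le_add (h _ ((le_self_add.trans_lt hf).trans_le (min_le_left _ _)))
          (h' _ ((le_add_self.trans_lt hf).trans_le (min_le_right _ _)))
    _ < ε := by rwa [ENNReal.add_halves]

lemma sobolevModular_le_of_sobolevNorm_lt
    (hq : IsVariableExponent (volume.restrict Ω) q)
    (hp : IsVariableExponent (volume.restrict (Ω ×ˢ Ω)) p) {ε : ℝ≥0∞} (hε : ε ≤ 1)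
    (h : sobolevNorm Ω s q p u < ε) : sobolevModular Ω s q p u ≤ 2 * ε := by
  rw [sobolevNorm, lebesgueNorm_eq, gagliardoSeminorm_eq] at h
  rw [sobolevModular, lebesgueModular_eq, gagliardoModular_eq, two_mul]
  exact add_le_add
    (modular_le_of_luxemburg_lt hq.one_le (fun _ => zero_le_one) hε (le_self_add.trans_lt h))
    (modular_le_of_luxemburg_lt hp.one_le gagliardoWeight_nonneg hε (le_add_self.trans_lt h))

/-- The closure defining `W̃` may be taken with respect to convergence in modular. -/
lemma memSobolevTilde_iff (hq : IsVariableExponent (volume.restrict Ω) q)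
    (hp : IsVariableExponent (volume.restrict (Ω ×ˢ Ω)) p) :
    MemSobolevTilde Ω s q p u ↔ MemSobolev Ω s q p u ∧ ∀ ε : ℝ≥0∞, 0 < ε →
      ∃ φ : EuclideanSpace ℝ (Fin n) → ℝ, MemSobolev Ω s q p φ ∧ IsContCompactSupp Ω φ ∧
        sobolevModular Ω s q p (fun x => u x - φ x) < ε := by
  refine and_congr_right fun _ => ⟨fun h ε hε => ?_, fun h ε hε => ?_⟩
  · obtain ⟨η, hη0, hηε⟩ := exists_between hε
    obtain ⟨φ, h1, h2, h3⟩ := h (min (η / 2) 1) (lt_min (ENNReal.half_pos hη0.ne') one_pos)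
    refine ⟨φ, h1, h2, ?_⟩
    calc _ ≤ 2 * min (η / 2) 1 :=
          sobolevModular_le_of_sobolevNorm_lt hq hp (min_le_right _ _) h3
      _ ≤ 2 * (η / 2) := by gcongr; exact min_le_left _ _
      _ = η := ENNReal.mul_div_cancel (by simp) (by simp)
      _ < ε := hηε
  · obtain ⟨δ, hδ, hδε⟩ := exists_sobolevModular_lt_imp_sobolevNorm_lt (s := s) hq hp hε
    obtain ⟨φ, h1, h2, h3⟩ := h δ hδ
    exact ⟨φ, h1, h2, hδε _ h3⟩

lemma MemSobolev.add (hq : IsVariableExponent (volume.restrict Ω) q)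
    (hp : IsVariableExponent (volume.restrict (Ω ×ˢ Ω)) p)
    (hu : MemSobolev Ω s q p u) (hv : MemSobolev Ω s q p v) :
    MemSobolev Ω s q p (fun x => u x + v x) := by
  rw [memSobolev_iff hq hp] at *
  obtain ⟨C, hC, h⟩ := sobolevModular_add_le (s := s) hq hp
  exact ⟨hu.1.add hv.1, (h u v hu.1).trans_lt
    (ENNReal.mul_lt_top hC.lt_top (ENNReal.add_lt_top.2 ⟨hu.2, hv.2⟩))⟩

lemma MemSobolev.abs (hq : IsVariableExponent (volume.restrict Ω) q)
    (hp : IsVariableExponent (volume.restrict (Ω ×ˢ Ω)) p)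
    (hu : MemSobolev Ω s q p u) : MemSobolev Ω s q p (fun x => |u x|) := by
  rw [memSobolev_iff hq hp] at *
  exact ⟨hu.1.abs, (sobolevModular_abs_le hq hp u).trans_lt hu.2⟩

lemma IsContCompactSupp.add (hu : IsContCompactSupp Ω u) (hv : IsContCompactSupp Ω v) :
    IsContCompactSupp Ω (fun x => u x + v x) := by
  obtain ⟨h1, K, hK, hKΩ, h2⟩ := hu
  obtain ⟨h1', K', hK', hKΩ', h2'⟩ := hv
  refine ⟨h1.add h1', K ∪ K', hK.union hK', Set.union_subset hKΩ hKΩ', fun x hx => ?_⟩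
  simp only [h2 x ⟨hx.1, fun h => hx.2 (Or.inl h)⟩, h2' x ⟨hx.1, fun h => hx.2 (Or.inr h)⟩,
    add_zero]

lemma IsContCompactSupp.abs (hu : IsContCompactSupp Ω u) :
    IsContCompactSupp Ω (fun x => |u x|) := by
  obtain ⟨h1, K, hK, hKΩ, h2⟩ := hu
  exact ⟨h1.abs, K, hK, hKΩ, fun x hx => by simp only [h2 x hx, abs_zero]⟩

lemma memSobolevTilde_zero (hq : IsVariableExponent (volume.restrict Ω) q)
    (hp : IsVariableExponent (volume.restrict (Ω ×ˢ Ω)) p) :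
    MemSobolevTilde Ω s q p (fun _ => 0) := by
  have h0 : MemSobolev Ω s q p (fun _ => 0) := by
    rw [memSobolev_iff hq hp, sobolevModular_zero hq hp]
    exact ⟨aemeasurable_const, by simp⟩
  rw [memSobolevTilde_iff hq hp]
  refine ⟨h0, fun ε hε => ⟨fun _ => 0, h0, ⟨continuousOn_const, ∅, isCompact_empty, by simp,
    fun _ _ => rfl⟩, ?_⟩⟩
  simpa [sobolevModular_zero hq hp] using hε

lemma MemSobolevTilde.add (hq : IsVariableExponent (volume.restrict Ω) q)
    (hp : IsVariableExponent (volume.restrict (Ω ×ˢ Ω)) p)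
    (hu : MemSobolevTilde Ω s q p u) (hv : MemSobolevTilde Ω s q p v) :
    MemSobolevTilde Ω s q p (fun x => u x + v x) := by
  rw [memSobolevTilde_iff hq hp] at *
  obtain ⟨C, hC, h⟩ := sobolevModular_add_le (s := s) hq hp
  refine ⟨hu.1.add hq hp hv.1, fun ε hε => ?_⟩
  have hδ : 0 < ε / (C + 1) / 2 :=
    ENNReal.half_pos (ENNReal.div_pos hε.ne' (by simp [hC])).ne'
  obtain ⟨φ, hφ1, hφ2, hφ3⟩ := hu.2 _ hδ
  obtain ⟨ψ, hψ1, hψ2, hψ3⟩ := hv.2 _ hδ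
  refine ⟨_, hφ1.add hq hp hψ1, hφ2.add hψ2, ?_⟩
  have e := h (fun x => u x - φ x) (fun x => v x - ψ x) (hu.1.1.sub hφ1.1)
  have e' : (fun x => u x + v x - (φ x + ψ x)) = fun x => (u x - φ x) + (v x - ψ x) := by
    ext x; ring
  rw [e']
  have hlt := ENNReal.add_lt_add hφ3 hψ3
  rw [ENNReal.add_halves] at hlt
  calc _ ≤ (C + 1) * _ := e.trans (by gcongr; exact le_self_add)
    _ < (C + 1) * (ε / (C + 1)) :=
        (ENNReal.mul_lt_mul_iff_right (by simp) (by simp [hC])).2 hlt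
    _ ≤ ε := ENNReal.mul_div_le

/-- `W̃` is stable under taking absolute values. The approximants `|φ k|` of `|u|` converge by the
generalized dominated convergence theorem, the difference of the two Gagliardo differences being
dominated by that of `φ k - u` and twice that of `u`. -/
lemma MemSobolevTilde.abs (hq : IsVariableExponent (volume.restrict Ω) q)
    (hp : IsVariableExponent (volume.restrict (Ω ×ˢ Ω)) p)
    (hu : MemSobolevTilde Ω s q p u) : MemSobolevTilde Ω s q p (fun x => |u x|) := by
  rw [memSobolevTilde_iff hq hp] at *
  refine ⟨hu.1.abs hq hp, ?_⟩
  have hpos : ∀ k : ℕ, (0 : ℝ≥0∞) < 2⁻¹ ^ k := fun k => ENNReal.pow_pos (by simp) k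
  choose φ hφ1 hφ2 hφ3 using fun k : ℕ => hu.2 (2⁻¹ ^ k) (hpos k)
  have hm : ∀ k, AEMeasurable (fun x => u x - φ k x) (volume.restrict Ω) :=
    fun k => hu.1.1.sub (hφ1 k).1
  have hpow : Tendsto (fun k : ℕ => (2⁻¹ : ℝ≥0∞) ^ k) atTop (𝓝 0) :=
    ENNReal.tendsto_pow_atTop_nhds_zero_of_lt_one (by simp)
  simp only [sobolevModular, lebesgueModular_eq, gagliardoModular_eq] at hφ3 ⊢
  have hL : Tendsto (fun k => modular (volume.restrict Ω) q (fun _ => 1) fun x => u x - φ k x)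
      atTop (𝓝 0) :=
    tendsto_of_tendsto_of_tendsto_of_le_of_le tendsto_const_nhds hpow (fun _ => zero_le)
      fun k => le_self_add.trans (hφ3 k).le
  have hG : Tendsto (fun k => modular (volume.restrict (Ω ×ˢ Ω)) p (gagliardoWeight s p)
      (pairDiff fun x => u x - φ k x)) atTop (𝓝 0) :=
    tendsto_of_tendsto_of_tendsto_of_le_of_le tendsto_const_nhds hpow (fun _ => zero_le)
      fun k => le_add_self.trans (hφ3 k).le
  have hae := ae_tendsto_zero_of_modular_le hq.one_le hq.1 hm
    fun k => le_self_add.trans (hφ3 k).le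
  have habs : ∀ᵐ x ∂(volume.restrict Ω), Tendsto (fun k => |u x| - |φ k x|) atTop (𝓝 0) := by
    filter_upwards [hae] with x hx
    exact squeeze_zero_norm (fun k => abs_abs_sub_abs_le _ _) (by simpa using hx.abs)
  have hL' : Tendsto (fun k => modular (volume.restrict Ω) q (fun _ => 1)
      fun x => |u x| - |φ k x|) atTop (𝓝 0) :=
    tendsto_of_tendsto_of_tendsto_of_le_of_le tendsto_const_nhds hL (fun _ => zero_le)
      fun k => modular_mono hq.one_le (fun _ => zero_le_one)
        (ae_of_all _ fun x => abs_abs_sub_abs_le _ _)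
  obtain ⟨b, hb⟩ := hp.exists_bound
  have hufin : modular (volume.restrict (Ω ×ˢ Ω)) p (gagliardoWeight s p) (pairDiff u) < ∞ :=
    le_add_self.trans_lt ((memSobolev_iff hq hp).1 hu.1).2
  have hG' : Tendsto (fun k => modular (volume.restrict (Ω ×ˢ Ω)) p (gagliardoWeight s p)
      (pairDiff fun x => |u x| - |φ k x|)) atTop (𝓝 0) := by
    refine tendsto_modular_of_dominated hb gagliardoWeight_nonneg hp.1
      (aemeasurable_gagliardoWeight hp.1) (g := fun k => pairDiff fun x => u x - φ k x)
      (h := fun z => 2 * pairDiff u z)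
      (fun k => aemeasurable_pairDiff (hu.1.1.abs.sub (hφ1 k).1.abs))
      (fun k => aemeasurable_pairDiff (hm k)) (fun k => ae_of_all _ fun z => ?_) ?_ hG
      ((modular_const_mul_le hb gagliardoWeight_nonneg _ 2).trans_lt
        (ENNReal.mul_lt_top ENNReal.ofReal_lt_top hufin))
    · simp only [pairDiff]
      have e1 : |(|u z.1| - |φ k z.1| - (|u z.2| - |φ k z.2|))| ≤
          |u z.1 - u z.2| + |φ k z.1 - φ k z.2| := by
        have e : |u z.1| - |φ k z.1| - (|u z.2| - |φ k z.2|) =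
          (|u z.1| - |u z.2|) - (|φ k z.1| - |φ k z.2|) := by ring
        rw [e]
        exact (abs_sub _ _).trans
          (add_le_add (abs_abs_sub_abs_le _ _) (abs_abs_sub_abs_le _ _))
      have e2 : |φ k z.1 - φ k z.2| ≤
          |u z.1 - φ k z.1 - (u z.2 - φ k z.2)| + |u z.1 - u z.2| := by
        have e : φ k z.1 - φ k z.2 =
          (u z.1 - u z.2) - (u z.1 - φ k z.1 - (u z.2 - φ k z.2)) := by ring
        rw [e]
        exact (abs_sub _ _).trans (add_comm _ _).le
      rw [abs_mul, abs_two]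
      linarith
    · filter_upwards [ae_pair_of_ae habs] with z hz
      simpa [pairDiff] using hz.1.sub hz.2
  intro ε hε
  have hsum := hL'.add hG'
  rw [add_zero] at hsum
  obtain ⟨k, hk⟩ := (hsum.eventually_lt_const hε).exists
  exact ⟨_, (hφ1 k).abs hq hp, (hφ2 k).abs, hk⟩

end

/-! ### Sets of capacity zero and quasicontinuous functions -/

section

variable {n : ℕ} {Ω : Set (EuclideanSpace ℝ (Fin n))} {s : ℝ} {q : EuclideanSpace ℝ (Fin n) → ℝ}
  {p : EuclideanSpace ℝ (Fin n) × EuclideanSpace ℝ (Fin n) → ℝ}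
  {v φ : EuclideanSpace ℝ (Fin n) → ℝ} {A B N : Set (EuclideanSpace ℝ (Fin n))}

lemma relCapacity_lt_iff {c : ℝ≥0∞} : relCapacity Ω s q p A < c ↔
    ∃ O, IsRelOpen Ω O ∧ A ⊆ O ∧ openCapacity Ω s q p O < c := by
  simp only [relCapacity, iInf_lt_iff, exists_prop]

lemma openCapacity_lt_iff {c : ℝ≥0∞} : openCapacity Ω s q p A < c ↔
    ∃ u, MemSobolevTilde Ω s q p u ∧ (∀ᵐ x ∂(volume.restrict Ω), x ∈ A → 1 ≤ u x) ∧
      sobolevModular Ω s q p u < c := by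
  simp only [openCapacity, iInf_lt_iff, exists_prop]

lemma relCapacity_mono (h : A ⊆ B) : relCapacity Ω s q p A ≤ relCapacity Ω s q p B :=
  le_iInf fun O => le_iInf fun hO => le_iInf fun hB =>
    iInf_le_of_le O (iInf_le_of_le hO (iInf_le _ (h.trans hB)))

lemma relCapacity_eq_zero_of_subset (h : A ⊆ B) (hB : relCapacity Ω s q p B = 0) :
    relCapacity Ω s q p A = 0 :=
  le_antisymm ((relCapacity_mono h).trans hB.le) zero_le

lemma relCapacity_empty (hq : IsVariableExponent (volume.restrict Ω) q)
    (hp : IsVariableExponent (volume.restrict (Ω ×ˢ Ω)) p) :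
    relCapacity Ω s q p ∅ = 0 := by
  refine le_antisymm (le_of_forall_gt fun c hc => ?_) zero_le
  rw [relCapacity_lt_iff]
  refine ⟨∅, ⟨∅, isOpen_empty, by simp⟩, subset_rfl, openCapacity_lt_iff.2
    ⟨fun _ => 0, memSobolevTilde_zero hq hp, by simp, ?_⟩⟩
  rwa [sobolevModular_zero hq hp]

/-- The condition `u ≥ 1` a.e. does not see null sets, and neither does the capacity of a
relatively open set. -/
lemma openCapacity_congr (h : ∀ᵐ x ∂(volume.restrict Ω), x ∈ A ↔ x ∈ B) :
    openCapacity Ω s q p A = openCapacity Ω s q p B := by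
  unfold openCapacity
  congr! 4 with u hu
  exact ⟨fun H => by filter_upwards [h, H] with x h1 h2 h3 using h2 (h1.2 h3),
    fun H => by filter_upwards [h, H] with x h1 h2 h3 using h2 (h1.1 h3)⟩

lemma IsRelOpen.union (hA : IsRelOpen Ω A) (hB : IsRelOpen Ω B) : IsRelOpen Ω (A ∪ B) := by
  obtain ⟨U, hU, rfl⟩ := hA
  obtain ⟨V, hV, rfl⟩ := hB
  exact ⟨U ∪ V, hU.union hV, (Set.inter_union_distrib_left _ _ _).symm⟩

/-- If `u` and `v` are admissible for two relatively open sets then `|u| + |v|` is admissible for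
their union. -/
lemma relCapacity_union_eq_zero (hq : IsVariableExponent (volume.restrict Ω) q)
    (hp : IsVariableExponent (volume.restrict (Ω ×ˢ Ω)) p)
    (hA : relCapacity Ω s q p A = 0) (hB : relCapacity Ω s q p B = 0) :
    relCapacity Ω s q p (A ∪ B) = 0 := by
  refine le_antisymm (le_of_forall_gt fun ε hε => ?_) zero_le
  obtain ⟨C, hC, h⟩ := sobolevModular_add_le (s := s) hq hp
  have hδ : 0 < ε / (C + 1) / 2 :=
    ENNReal.half_pos (ENNReal.div_pos hε.ne' (by simp [hC])).ne'
  obtain ⟨O, hO, hAO, hcO⟩ := relCapacity_lt_iff.1 (hA.trans_lt hδ)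
  obtain ⟨O', hO', hBO, hcO'⟩ := relCapacity_lt_iff.1 (hB.trans_lt hδ)
  obtain ⟨u, hu, hu1, hu2⟩ := openCapacity_lt_iff.1 hcO
  obtain ⟨v, hv, hv1, hv2⟩ := openCapacity_lt_iff.1 hcO'
  refine relCapacity_lt_iff.2 ⟨O ∪ O', hO.union hO', Set.union_subset_union hAO hBO,
    openCapacity_lt_iff.2 ⟨_, (hu.abs hq hp).add hq hp (hv.abs hq hp), ?_, ?_⟩⟩
  · filter_upwards [hu1, hv1] with x h1 h2 hx
    rcases hx with hx | hx
    · linarith [h1 hx, le_abs_self (u x), abs_nonneg (v x)]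
    · linarith [h2 hx, le_abs_self (v x), abs_nonneg (u x)]
  · have hlt := ENNReal.add_lt_add ((sobolevModular_abs_le hq hp u).trans_lt hu2)
      ((sobolevModular_abs_le hq hp v).trans_lt hv2)
    rw [ENNReal.add_halves] at hlt
    calc _ ≤ (C + 1) * _ := (h _ _ hu.1.1.abs).trans (by gcongr; exact le_self_add)
      _ < (C + 1) * (ε / (C + 1)) :=
          (ENNReal.mul_lt_mul_iff_right (by simp) (by simp [hC])).2 hlt
      _ ≤ ε := ENNReal.mul_div_le

/-- Sets of capacity zero are Lebesgue null: an admissible `u` for `O` has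
`ρ(u) ≥ ∫_Ω |u|^q ≥ |O ∩ Ω|`. -/
lemma ae_notMem_of_relCapacity_eq_zero (hq : IsVariableExponent (volume.restrict Ω) q)
    (hA : relCapacity Ω s q p A = 0) : ∀ᵐ x ∂(volume.restrict Ω), x ∉ A := by
  have key : volume.restrict Ω A ≤ 0 := by
    refine le_of_forall_gt fun ε hε => ?_
    obtain ⟨O, ⟨U, hU, rfl⟩, hAO, hcO⟩ := relCapacity_lt_iff.1 (hA.trans_lt hε)
    obtain ⟨u, hu, hu1, hu2⟩ := openCapacity_lt_iff.1 hcO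
    have hm : MeasurableSet (closure Ω ∩ U) := isClosed_closure.measurableSet.inter hU.measurableSet
    refine lt_of_le_of_lt ?_ hu2
    calc volume.restrict Ω A ≤ volume.restrict Ω (closure Ω ∩ U) := measure_mono hAO
      _ = ∫⁻ x in Ω, (closure Ω ∩ U).indicator 1 x := (lintegral_indicator_one hm).symm
      _ ≤ lebesgueModular Ω q u := by
          refine lintegral_mono_ae ?_
          filter_upwards [hu1, hq.one_le] with x hx hqx
          by_cases hxO : x ∈ closure Ω ∩ U
          · rw [Set.indicator_of_mem hxO, Pi.one_apply, ENNReal.one_le_ofReal]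
            exact Real.one_le_rpow ((hx hxO).trans (le_abs_self _)) (by linarith)
          · simp [Set.indicator_of_notMem hxO]
      _ ≤ _ := le_self_add
  exact measure_eq_zero_iff_ae_notMem.1 (le_antisymm key zero_le)

lemma ContinuousOn.relQuasicontinuous (hq : IsVariableExponent (volume.restrict Ω) q)
    (hp : IsVariableExponent (volume.restrict (Ω ×ˢ Ω)) p) (h : ContinuousOn φ (closure Ω)) :
    RelQuasicontinuous Ω s q p φ := fun ε hε =>
  ⟨∅, ⟨∅, isOpen_empty, by simp⟩, by rwa [relCapacity_empty hq hp], by simpa using h⟩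

/-- A quasicontinuous function that agrees a.e. with a continuous one agrees with it r.q.e.:
off an open set `O` of small capacity, the set where they differ is relatively open, hence its union
with `O` is open, and it has the capacity of `O` since it differs from `O` by a null set. -/
lemma relCapacity_ne_eq_zero (hv : RelQuasicontinuous Ω s q p v)
    (hφ : ContinuousOn φ (closure Ω)) (h : v =ᵐ[volume.restrict Ω] φ) :
    relCapacity Ω s q p {x ∈ closure Ω | v x ≠ φ x} = 0 := by
  refine le_antisymm (le_of_forall_gt fun ε hε => ?_) zero_le
  obtain ⟨O₀, -, hcO₀, hcont₀⟩ := hv ε hε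
  -- Enlarging `O₀` to a competitor `O` trades the infimum `relCapacity O₀` for `openCapacity O`.
  obtain ⟨O, ⟨U, hU, hOU⟩, hO₀O, hcO⟩ := relCapacity_lt_iff.1 hcO₀
  have hcont : ContinuousOn (fun x => v x - φ x) (closure Ω \ O) :=
    (hcont₀.mono (Set.sdiff_subset_sdiff_right hO₀O)).sub (hφ.mono Set.sdiff_subset)
  obtain ⟨V, hV, hVeq⟩ := continuousOn_iff'.1 hcont {0}ᶜ isOpen_compl_singleton
  have hmem : ∀ x ∈ closure Ω \ O, x ∈ V ↔ v x ≠ φ x := by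
    intro x hx
    have := Set.ext_iff.1 hVeq x
    simp only [Set.mem_inter_iff, Set.mem_preimage, Set.mem_compl_iff, Set.mem_singleton_iff,
      sub_eq_zero, hx, and_true] at this
    exact this.symm
  refine relCapacity_lt_iff.2 ⟨{x ∈ closure Ω | v x ≠ φ x} ∪ O, ⟨V ∪ U, hV.union hU, ?_⟩,
    Set.subset_union_left, ?_⟩
  · ext x
    by_cases hxO : x ∈ O
    · have := hOU ▸ hxO
      simp [hxO, this.1, this.2]
    · by_cases hxΩ : x ∈ closure Ω
      · have hxU : x ∉ U := fun hx => hxO (hOU ▸ ⟨hxΩ, hx⟩)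
        simp [hxO, hxΩ, hxU, hmem x ⟨hxΩ, hxO⟩]
      · simp [hxO, hxΩ]
  · rwa [openCapacity_congr (B := O)]
    filter_upwards [h] with x hx
    simp [hx]

/-! ### The zero trace spaces -/

/-- A function belongs to the zero trace space of `A` if it has a quasicontinuous representative
in `W̃` vanishing r.q.e. off `A`: since sets of capacity zero are null, such a representative is
a.e. the extension by zero of its restriction to `A`. -/
lemma mem_zeroTraceSpace_iff (hΩ : MeasurableSet Ω)
    (hq : IsVariableExponent (volume.restrict Ω) q)
    {f : EuclideanSpace ℝ (Fin n) →ₘ[volume.restrict Ω] ℝ} :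
    f ∈ zeroTraceSpace Ω s q p A ↔ ∃ v : EuclideanSpace ℝ (Fin n) → ℝ,
      RelQuasicontinuous Ω s q p v ∧ MemSobolevTilde Ω s q p v ∧ f =ᵐ[volume.restrict Ω] v ∧
      RelQuasiEverywhere Ω s q p (closure Ω \ A) (fun x => v x = 0) := by
  have key : ∀ (u : A → ℝ) (v : EuclideanSpace ℝ (Fin n) → ℝ),
      (∀ᵐ x ∂(volume : Measure (EuclideanSpace ℝ (Fin n))), ∀ h : x ∈ A, v x = u ⟨x, h⟩) →
      RelQuasiEverywhere Ω s q p (closure Ω \ A) (fun x => v x = 0) →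
      Function.extend Subtype.val u 0 =ᵐ[volume.restrict Ω] v := by
    rintro u v h1 ⟨Z, hZA, hZ, hv⟩
    filter_upwards [ae_restrict_of_ae h1, ae_notMem_of_relCapacity_eq_zero hq hZ,
      ae_restrict_mem hΩ] with x hx1 hxZ hxΩ
    by_cases hxA : x ∈ A
    · rw [hx1 hxA]
      exact Subtype.val_injective.extend_apply u 0 ⟨x, hxA⟩
    · rw [Function.extend_apply' _ _ _ (by rintro ⟨y, rfl⟩; exact hxA y.2)]
      exact (hv x ⟨⟨subset_closure hxΩ, hxA⟩, hxZ⟩).symm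
  constructor
  · rintro ⟨u, ⟨v, h1, h2, h3, h4⟩, hf⟩
    exact ⟨v, h1, h2, hf.trans (key u v h3 h4), h4⟩
  · rintro ⟨v, h1, h2, h3, h4⟩
    have h5 : ∀ᵐ x ∂(volume : Measure (EuclideanSpace ℝ (Fin n))),
      ∀ h : x ∈ A, v x = (fun y : A => v y) ⟨x, h⟩ := ae_of_all _ fun x _ => rfl
    exact ⟨fun y => v y, ⟨v, h1, h2, h5, h4⟩, h3.trans (key _ v h5 h4).symm⟩

/-- Removing a set of capacity zero from `Ω` does not change the condition of vanishing r.q.e. off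
the set. Conversely, vanishing r.q.e. off `Ω \ N` always implies vanishing r.q.e. off `Ω`. -/
lemma isRemovable_of_relCapacity_eq_zero (hΩ : MeasurableSet Ω)
    (hq : IsVariableExponent (volume.restrict Ω) q)
    (hp : IsVariableExponent (volume.restrict (Ω ×ˢ Ω)) p) (hN : relCapacity Ω s q p N = 0) :
    IsRemovable Ω s q p N := by
  ext f
  rw [mem_zeroTraceSpace_iff hΩ hq, mem_zeroTraceSpace_iff hΩ hq]
  refine exists_congr fun v => and_congr_right fun _ => and_congr_right fun _ =>
    and_congr_right fun _ => ⟨?_, ?_⟩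
  · rintro ⟨Z, hZ, hZ0, hv⟩
    refine ⟨(Z ∪ N) ∩ (closure Ω \ (Ω \ N)), Set.inter_subset_right,
      relCapacity_eq_zero_of_subset Set.inter_subset_left
        (relCapacity_union_eq_zero hq hp hZ0 hN), fun x hx => ?_⟩
    have hxZN : x ∉ Z ∪ N := fun h => hx.2 ⟨h, hx.1⟩
    have hxN : x ∉ N := fun h => hxZN (Or.inr h)
    exact hv x ⟨⟨hx.1.1, fun h => hx.1.2 ⟨h, hxN⟩⟩, fun h => hxZN (Or.inl h)⟩
  · rintro ⟨Z, hZ, hZ0, hv⟩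
    refine ⟨Z ∩ (closure Ω \ Ω), Set.inter_subset_right,
      relCapacity_eq_zero_of_subset Set.inter_subset_left hZ0, fun x hx => ?_⟩
    exact hv x ⟨⟨hx.1.1, fun h => hx.1.2 h.1⟩, fun h => hx.2 ⟨h, hx.1⟩⟩

/-- If `W̃` has a continuous element `φ` whose zero set is the complement of `Ω`, removable sets
have capacity zero: the quasicontinuous representative of `φ` that vanishes r.q.e. on `N` equals
`φ ≠ 0` r.q.e. -/
lemma relCapacity_eq_zero_of_isRemovable (hΩ : MeasurableSet Ω)
    (hq : IsVariableExponent (volume.restrict Ω) q)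
    (hp : IsVariableExponent (volume.restrict (Ω ×ˢ Ω)) p) (hN : N ⊆ Ω)
    (hφ : Continuous φ) (hφT : MemSobolevTilde Ω s q p φ) (hφpos : ∀ x ∈ Ω, φ x ≠ 0)
    (hφ0 : ∀ x ∉ Ω, φ x = 0) (h : IsRemovable Ω s q p N) : relCapacity Ω s q p N = 0 := by
  set f : EuclideanSpace ℝ (Fin n) →ₘ[volume.restrict Ω] ℝ :=
    AEEqFun.mk φ hφ.aestronglyMeasurable
  have hf : f =ᵐ[volume.restrict Ω] φ := AEEqFun.coeFn_mk _ _
  have h1 : f ∈ zeroTraceSpace Ω s q p Ω :=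
    (mem_zeroTraceSpace_iff hΩ hq).2 ⟨φ,
      ContinuousOn.relQuasicontinuous hq hp hφ.continuousOn, hφT, hf,
      ∅, Set.empty_subset _, relCapacity_empty hq hp, fun x hx => hφ0 x hx.1.2⟩
  rw [h] at h1
  obtain ⟨v, hv, -, hfv, Z, -, hZ0, hvZ⟩ := (mem_zeroTraceSpace_iff hΩ hq).1 h1
  refine relCapacity_eq_zero_of_subset ?_ (relCapacity_union_eq_zero hq hp
    (relCapacity_ne_eq_zero hv hφ.continuousOn (hfv.symm.trans hf)) hZ0)
  intro x hx
  by_cases hxZ : x ∈ Z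
  · exact Or.inr hxZ
  · have hxc := subset_closure (hN hx)
    refine Or.inl ⟨hxc, ?_⟩
    rw [hvZ x ⟨⟨hxc, fun h => h.2 hx⟩, hxZ⟩]
    exact (hφpos x (hN hx)).symm

end

/-! ### A positive continuous function vanishing off `Ω` -/

section

variable {n : ℕ} {Ω : Set (EuclideanSpace ℝ (Fin n))} {s : ℝ} {q : EuclideanSpace ℝ (Fin n) → ℝ}
  {p : EuclideanSpace ℝ (Fin n) × EuclideanSpace ℝ (Fin n) → ℝ}
  {φ : EuclideanSpace ℝ (Fin n) → ℝ}

lemma lintegral_exp_neg_mul_norm_lt_top {β : ℝ} (hβ : 0 < β) :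
    ∫⁻ x : EuclideanSpace ℝ (Fin n), ENNReal.ofReal (Real.exp (-(β * ‖x‖))) < ∞ := by
  have hint : Integrable fun x : EuclideanSpace ℝ (Fin n) =>
      (1 + ‖x‖) ^ (-((n + 1 : ℕ) : ℝ)) := integrable_one_add_norm (by simp)
  set C : ℝ := Real.exp β * ((n + 1).factorial / β ^ (n + 1))
  refine lt_of_le_of_lt (lintegral_mono fun x => ENNReal.ofReal_le_ofReal ?_)
    (hint.const_mul C).lintegral_lt_top
  have h1 := Real.pow_div_factorial_le_exp (β * (1 + ‖x‖)) (by positivity) (n + 1)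
  rw [Real.rpow_neg (by positivity), Real.rpow_natCast]
  have h2 : Real.exp (-(β * ‖x‖)) = Real.exp β * (Real.exp (β * (1 + ‖x‖)))⁻¹ := by
    rw [← Real.exp_neg, ← Real.exp_add]; ring_nf
  have h3 : (Real.exp (β * (1 + ‖x‖)))⁻¹ ≤ ((β * (1 + ‖x‖)) ^ (n + 1) / (n + 1).factorial)⁻¹ :=
    inv_anti₀ (by positivity) h1
  calc Real.exp (-(β * ‖x‖)) ≤
        Real.exp β * ((β * (1 + ‖x‖)) ^ (n + 1) / (n + 1).factorial)⁻¹ := by rw [h2]; gcongr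
    _ = _ := by simp only [C]; rw [mul_pow]; field_simp

/-- The integrable kernel `|z|^{β - n}` near the origin and `|z|^{-(n + s)}` away from it, which
dominates `|x - y|^{-(n + s p(x, y))}` at `z = x - y` once a power of `|x - y|` is gained from a
Lipschitz bound. -/
noncomputable def gagliardoKernel (n : ℕ) (β s : ℝ) (z : EuclideanSpace ℝ (Fin n)) : ℝ :=
  if ‖z‖ < 1 then ‖z‖ ^ (β - n) else ‖z‖ ^ (-(n + s))

lemma measurable_gagliardoKernel (n : ℕ) (β s : ℝ) : Measurable (gagliardoKernel n β s) :=
  Measurable.ite (measurableSet_lt measurable_norm measurable_const)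
    (measurable_norm.pow_const _) (measurable_norm.pow_const _)

lemma gagliardoKernel_nonneg (n : ℕ) (β s : ℝ) (z : EuclideanSpace ℝ (Fin n)) :
    0 ≤ gagliardoKernel n β s z := by
  unfold gagliardoKernel; split_ifs <;> positivity

lemma lintegral_gagliardoKernel_lt_top {β : ℝ} (hβ : 0 < β) (hs : 0 < s) :
    ∫⁻ z, ENNReal.ofReal (gagliardoKernel n β s z) < ∞ := by
  rcases Nat.eq_zero_or_pos n with rfl | hn
  -- In dimension zero the space is a point and polar coordinates are not available.
  · calc _ ≤ ∫⁻ _ : EuclideanSpace ℝ (Fin 0), ENNReal.ofReal (gagliardoKernel 0 β s 0) :=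
          lintegral_mono fun z => by rw [Subsingleton.elim z 0]
      _ < ∞ := by
          rw [lintegral_const]
          exact ENNReal.mul_lt_top ENNReal.ofReal_lt_top
            ((Set.toFinite _).isCompact.measure_lt_top)
  have hball : IntegrableOn (gagliardoKernel n β s) (Metric.ball 0 1) := by
    refine integrableOn_ball_of_norm_le_rpow (α := n - β) (C := 1)
      (by rw [finrank_euclideanSpace_fin]; exact hn)
      (by simpa using hβ) ?_ (measurable_gagliardoKernel n β s).aestronglyMeasurable
    filter_upwards [ae_restrict_mem Metric.isOpen_ball.measurableSet] with z hz
    rw [mem_ball_zero_iff] at hz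
    rw [Real.norm_of_nonneg (gagliardoKernel_nonneg n β s z), gagliardoKernel, if_pos hz,
      one_mul, neg_sub]
  have hfar : IntegrableOn (gagliardoKernel n β s) (Metric.ball 0 1)ᶜ := by
    have hint : Integrable fun x : EuclideanSpace ℝ (Fin n) =>
        (1 + ‖x‖) ^ (-(n + s)) := integrable_one_add_norm (by simpa using hs)
    refine (hint.const_mul (2 ^ (n + s))).integrableOn.mono'
      (measurable_gagliardoKernel n β s).aestronglyMeasurable ?_
    filter_upwards [ae_restrict_mem Metric.isOpen_ball.measurableSet.compl] with z hz
    rw [Set.mem_compl_iff, mem_ball_zero_iff, not_lt] at hz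
    -- Here `|z| ≥ (1 + |z|) / 2`.
    rw [Real.norm_of_nonneg (gagliardoKernel_nonneg n β s z), gagliardoKernel, if_neg hz.not_gt,
      Real.rpow_neg (by positivity), Real.rpow_neg (by positivity), ← div_eq_mul_inv,
      ← Real.inv_rpow (by positivity), ← Real.div_rpow (by positivity) (by positivity)]
    refine Real.rpow_le_rpow (by positivity) ?_ (by positivity)
    rw [inv_eq_one_div, div_le_div_iff₀ (by linarith) (by positivity)]
    linarith
  have := hball.union hfar
  rw [Set.union_compl_self, integrableOn_univ] at this
  exact this.lintegral_lt_top

/-- The pointwise bound behind the finiteness of the Gagliardo modular: for `|t| ≤ min D M` with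
`M ≤ 1`, interpolation between the two bounds gives decay in `M` while leaving enough powers of
`D` to beat the singularity. -/
lemma rpow_div_rpow_le {t D M r : ℝ} (hs0 : 0 < s) (hs1 : s < 1) (hr : 1 ≤ r)
    (hD : 0 < D) (hM0 : 0 ≤ M) (hM1 : M ≤ 1) (htD : |t| ≤ D) (htM : |t| ≤ M) :
    |t| ^ r / D ^ (n + s * r) ≤ M ^ ((1 - s) / 2) *
      if D < 1 then D ^ ((1 - s) / 2 - n) else D ^ (-(n + s)) := by
  have hβ : 0 < (1 - s) / 2 := by linarith
  have hMβ : 0 ≤ M ^ ((1 - s) / 2) := by positivity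
  split_ifs with h
  · have e1 : |t| ^ r ≤ D ^ ((1 + s) / 2 * r) * M ^ ((1 - s) / 2) := by
      calc |t| ^ r = |t| ^ ((1 + s) / 2 * r) * |t| ^ ((1 - s) / 2 * r) := by
            rw [← Real.rpow_add_of_nonneg (abs_nonneg _) (by positivity) (by positivity)]
            congr 1; ring
        _ ≤ D ^ ((1 + s) / 2 * r) * M ^ ((1 - s) / 2 * r) := by
            gcongr
        _ ≤ _ := by
            gcongr ?_ * ?_
            rw [Real.rpow_mul hM0]
            exact Real.rpow_le_self_of_le_one hMβ (Real.rpow_le_one hM0 hM1 hβ.le) hr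
    calc _ ≤ D ^ ((1 + s) / 2 * r) * M ^ ((1 - s) / 2) / D ^ (n + s * r) := by gcongr
      _ = M ^ ((1 - s) / 2) * D ^ ((1 - s) / 2 * r - n) := by
          rw [mul_comm, mul_div_assoc, ← Real.rpow_sub hD]
          congr 2; ring
      _ ≤ _ := by
          gcongr 1
          exact Real.rpow_le_rpow_of_exponent_ge hD h.le (by nlinarith)
  · rw [not_lt] at h
    rw [div_eq_mul_inv, ← Real.rpow_neg hD.le]
    have e1 : |t| ^ r ≤ M ^ ((1 - s) / 2) := by
      calc |t| ^ r ≤ M ^ r := by gcongr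
        _ ≤ _ := Real.rpow_le_rpow_of_exponent_ge_of_imp hM0 hM1 (by linarith)
              (fun _ h0 => absurd h0 (by linarith : 0 < r).ne')
    have e2 : D ^ (-(n + s * r)) ≤ D ^ (-((n : ℝ) + s)) :=
      Real.rpow_le_rpow_of_exponent_le h (by nlinarith)
    gcongr

/-- Nonnegative `1`-Lipschitz functions below `exp(-|x|)` belong to the Sobolev space. The Gagliardo
integrand is at most `(γ(x) + γ(y)) κ(x - y)` with integrable `γ` and `κ`, whatever the exponent
`p(x, y) ≥ 1`. -/
lemma memSobolev_of_lipschitz_of_exp_decay (hs0 : 0 < s) (hs1 : s < 1)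
    (hq : IsVariableExponent (volume.restrict Ω) q)
    (hp : IsVariableExponent (volume.restrict (Ω ×ˢ Ω)) p)
    (hLip : ∀ x y, |φ x - φ y| ≤ ‖x - y‖) (h0 : ∀ x, 0 ≤ φ x)
    (hdecay : ∀ x, φ x ≤ Real.exp (-‖x‖)) : MemSobolev Ω s q p φ := by
  have hcont : Continuous φ := by
    refine (LipschitzWith.of_dist_le_mul (K := 1) fun x y => ?_).continuous
    simpa [Real.dist_eq, dist_eq_norm] using hLip x y
  set β : ℝ := (1 - s) / 2 with hβdef
  have hβ : 0 < β := by simp only [hβdef]; linarith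
  have hexp1 : ∀ x : EuclideanSpace ℝ (Fin n), Real.exp (-‖x‖) ≤ 1 :=
    fun x => Real.exp_le_one_iff.2 (by simp)
  have hexpβ : ∀ x : EuclideanSpace ℝ (Fin n),
      Real.exp (-‖x‖) ^ β = Real.exp (-(β * ‖x‖)) := by
    intro x; rw [← Real.exp_mul]; ring_nf
  set γ : EuclideanSpace ℝ (Fin n) → ℝ≥0∞ := fun x => ENNReal.ofReal (Real.exp (-(β * ‖x‖)))
  set κ : EuclideanSpace ℝ (Fin n) → ℝ≥0∞ := fun x => ENNReal.ofReal (gagliardoKernel n β s x)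
  have hγm : Measurable γ := by
    have : Continuous fun x : EuclideanSpace ℝ (Fin n) => Real.exp (-(β * ‖x‖)) := by fun_prop
    exact this.measurable.ennreal_ofReal
  have hκm : Measurable κ := (measurable_gagliardoKernel n β s).ennreal_ofReal
  have hγ : ∫⁻ x, γ x < ∞ := lintegral_exp_neg_mul_norm_lt_top hβ
  have hκ : ∫⁻ x, κ x < ∞ := lintegral_gagliardoKernel_lt_top hβ hs0
  rw [memSobolev_iff hq hp, sobolevModular, ENNReal.add_lt_top]
  refine ⟨hcont.aemeasurable, ?_, ?_⟩
  · refine (lintegral_mono_ae ?_).trans_lt ((setLIntegral_le_lintegral Ω γ).trans_lt hγ)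
    filter_upwards [hq.one_le] with x hx
    refine ENNReal.ofReal_le_ofReal ?_
    rw [abs_of_nonneg (h0 x), ← hexpβ]
    calc φ x ^ q x ≤ Real.exp (-‖x‖) ^ q x :=
          Real.rpow_le_rpow (h0 x) (hdecay x) (by linarith)
      _ ≤ _ := Real.rpow_le_rpow_of_exponent_ge (Real.exp_pos _) (hexp1 x)
          (by simp only [hβdef]; linarith)
  · have hbound : ∀ᵐ z ∂(volume.restrict (Ω ×ˢ Ω)),
        ENNReal.ofReal (|φ z.1 - φ z.2| ^ p z / ‖z.1 - z.2‖ ^ ((n : ℝ) + s * p z)) ≤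
          γ z.1 * κ (z.1 - z.2) + γ z.2 * κ (z.1 - z.2) := by
      filter_upwards [hp.one_le] with z hz
      -- On the diagonal both numerator and denominator vanish, and the quotient is `0`.
      rcases (norm_nonneg (z.1 - z.2)).eq_or_lt with hD | hD
      · have : z.1 = z.2 := sub_eq_zero.1 (norm_eq_zero.1 hD.symm)
        simp [this, Real.zero_rpow (show p z ≠ 0 by linarith)]
      rw [← add_mul, ← ENNReal.ofReal_add (by positivity) (by positivity),
        ← ENNReal.ofReal_mul (by positivity)]
      refine ENNReal.ofReal_le_ofReal ?_
      set M := max (Real.exp (-‖z.1‖)) (Real.exp (-‖z.2‖)) with hMdef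
      have hM0 : 0 ≤ M := le_max_of_le_left (Real.exp_pos _).le
      have htM : |φ z.1 - φ z.2| ≤ M := by
        have h1 : φ z.1 ≤ M := (hdecay _).trans (le_max_left _ _)
        have h2 : φ z.2 ≤ M := (hdecay _).trans (le_max_right _ _)
        rw [abs_sub_le_iff]
        constructor <;> linarith [h0 z.1, h0 z.2]
      refine (rpow_div_rpow_le hs0 hs1 hz hD hM0 (max_le (hexp1 _) (hexp1 _))
        (hLip _ _) htM).trans ?_
      refine mul_le_mul_of_nonneg_right ?_ (gagliardoKernel_nonneg n β s (z.1 - z.2))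
      rcases max_choice (Real.exp (-‖z.1‖)) (Real.exp (-‖z.2‖)) with h | h <;>
        rw [hMdef, h, hexpβ]
      · linarith [Real.exp_pos (-(β * ‖z.2‖))]
      · linarith [Real.exp_pos (-(β * ‖z.1‖))]
    have hm1 : Measurable fun z : EuclideanSpace ℝ (Fin n) × EuclideanSpace ℝ (Fin n) =>
        γ z.1 * κ (z.1 - z.2) :=
      (hγm.comp measurable_fst).mul (hκm.comp (measurable_fst.sub measurable_snd))
    have hm2 : Measurable fun z : EuclideanSpace ℝ (Fin n) × EuclideanSpace ℝ (Fin n) =>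
        γ z.2 * κ (z.1 - z.2) :=
      (hγm.comp measurable_snd).mul (hκm.comp (measurable_fst.sub measurable_snd))
    have hI1 : ∫⁻ z : EuclideanSpace ℝ (Fin n) × EuclideanSpace ℝ (Fin n),
        γ z.1 * κ (z.1 - z.2) = (∫⁻ x, γ x) * ∫⁻ x, κ x := by
      rw [Measure.volume_eq_prod, lintegral_prod _ hm1.aemeasurable]
      rw [← lintegral_mul_const _ hγm]
      refine lintegral_congr fun x => ?_
      have hm : Measurable fun y => κ (x - y) := hκm.comp (measurable_const.sub measurable_id)
      exact (lintegral_const_mul _ hm).trans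
        (congrArg (γ x * ·) (lintegral_sub_left_eq_self κ x))
    have hI2 : ∫⁻ z : EuclideanSpace ℝ (Fin n) × EuclideanSpace ℝ (Fin n),
        γ z.2 * κ (z.1 - z.2) = (∫⁻ x, γ x) * ∫⁻ x, κ x := by
      rw [Measure.volume_eq_prod, lintegral_prod_symm _ hm2.aemeasurable]
      rw [← lintegral_mul_const _ hγm]
      refine lintegral_congr fun y => ?_
      have hm : Measurable fun x => κ (x - y) := hκm.comp (measurable_id.sub measurable_const)
      exact (lintegral_const_mul _ hm).trans
        (congrArg (γ y * ·) (lintegral_sub_right_eq_self κ y))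
    refine (lintegral_mono_ae hbound).trans_lt ((setLIntegral_le_lintegral _ _).trans_lt ?_)
    rw [lintegral_add_left hm1, hI1, hI2]
    exact ENNReal.add_lt_top.2 ⟨ENNReal.mul_lt_top hγ hκ, ENNReal.mul_lt_top hγ hκ⟩

/-- A continuous function in the Sobolev space that vanishes off `Ω` and at infinity belongs to
`W̃`: it is the limit of the compactly supported truncations `(φ - ε)⁺`. -/
lemma memSobolevTilde_of_tendsto_cocompact (hq : IsVariableExponent (volume.restrict Ω) q)
    (hp : IsVariableExponent (volume.restrict (Ω ×ˢ Ω)) p) (hφ : Continuous φ)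
    (h0 : ∀ x, 0 ≤ φ x) (hΩ : ∀ x ∉ Ω, φ x = 0) (hlim : Tendsto φ (cocompact _) (𝓝 0))
    (hW : MemSobolev Ω s q p φ) : MemSobolevTilde Ω s q p φ := by
  rw [memSobolevTilde_iff hq hp]
  refine ⟨hW, ?_⟩
  have hW' := ((memSobolev_iff hq hp).1 hW).2
  rw [sobolevModular, ENNReal.add_lt_top, lebesgueModular_eq, gagliardoModular_eq] at hW'
  obtain ⟨b, hb⟩ := hq.exists_bound
  obtain ⟨b', hb'⟩ := hp.exists_bound
  set c : ℕ → ℝ := fun k => 1 / ((k : ℝ) + 1)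
  have hcpos : ∀ k, 0 < c k := fun k => by positivity
  have hc0 : Tendsto c atTop (𝓝 0) := tendsto_one_div_add_atTop_nhds_zero_nat
  have hdiff : ∀ k x, φ x - max (φ x - c k) 0 = min (φ x) (c k) := by
    intro k x
    rcases le_total (φ x) (c k) with h | h
    · rw [max_eq_right (by linarith), min_eq_left h, sub_zero]
    · rw [max_eq_left (by linarith), min_eq_right h]; ring
  have hmin : ∀ k (z : EuclideanSpace ℝ (Fin n) × EuclideanSpace ℝ (Fin n)),
      |min (φ z.1) (c k) - min (φ z.2) (c k)| ≤ |φ z.1 - φ z.2| := fun k z => by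
    simpa using abs_min_sub_min_le_max (φ z.1) (c k) (φ z.2) (c k)
  have hmin0 : ∀ x, Tendsto (fun k => min (φ x) (c k)) atTop (𝓝 0) := fun x => by
    simpa [h0 x] using (tendsto_const_nhds (x := φ x)).min hc0
  have hmcont : ∀ k, Continuous fun x => min (φ x) (c k) := fun k => hφ.min continuous_const
  have h1 : Tendsto (fun k => modular (volume.restrict Ω) q (fun _ => 1)
      fun x => min (φ x) (c k)) atTop (𝓝 0) := by
    refine tendsto_modular_of_dominated hb (fun _ => zero_le_one) hq.1 aemeasurable_const
      (g := fun _ _ => 0) (fun k => (hmcont k).aemeasurable) (fun _ => aemeasurable_const)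
      (fun k => ae_of_all _ fun x => ?_) (ae_of_all _ hmin0) ?_ hW'.1
    · rw [abs_zero, zero_add, abs_of_nonneg (h0 x), abs_of_nonneg (le_min (h0 x) (hcpos k).le)]
      exact min_le_left _ _
    · simp only [modular_zero hq.one_le, tendsto_const_nhds_iff]
  have h2 : Tendsto (fun k => modular (volume.restrict (Ω ×ˢ Ω)) p (gagliardoWeight s p)
      (pairDiff fun x => min (φ x) (c k))) atTop (𝓝 0) := by
    refine tendsto_modular_of_dominated hb' gagliardoWeight_nonneg hp.1
      (aemeasurable_gagliardoWeight hp.1)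
      (g := fun _ _ => 0) (fun k => aemeasurable_pairDiff (hmcont k).aemeasurable)
      (fun _ => aemeasurable_const)
      (fun k => ae_of_all _ fun z => ?_) (ae_of_all _ fun z => ?_) ?_ hW'.2
    · rw [abs_zero, zero_add]
      exact hmin k z
    · simpa [pairDiff] using (hmin0 z.1).sub (hmin0 z.2)
    · simp only [modular_zero hp.one_le, tendsto_const_nhds_iff]
  intro ε hε
  have hsum := h1.add h2
  rw [add_zero] at hsum
  obtain ⟨k, hk⟩ := (hsum.eventually_lt_const hε).exists
  have htr : Continuous fun x => max (φ x - c k) 0 := (hφ.sub continuous_const).max continuous_const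
  refine ⟨fun x => max (φ x - c k) 0, ?_, ⟨htr.continuousOn, {x | c k ≤ φ x}, ?_, ?_, ?_⟩, ?_⟩
  · rw [memSobolev_iff hq hp, sobolevModular, ENNReal.add_lt_top, lebesgueModular_eq,
      gagliardoModular_eq]
    refine ⟨htr.aemeasurable, (modular_mono hq.one_le (fun _ => zero_le_one)
      (ae_of_all _ fun x => ?_)).trans_lt hW'.1, (modular_mono hp.one_le gagliardoWeight_nonneg
      (ae_of_all _ fun z => ?_)).trans_lt hW'.2⟩
    · rw [abs_of_nonneg (h0 x), abs_of_nonneg (le_max_right _ _)]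
      exact max_le (by linarith [hcpos k]) (h0 x)
    · simpa [pairDiff] using abs_max_sub_max_le_max (φ z.1 - c k) 0 (φ z.2 - c k) 0
  · refine (Metric.isCompact_of_isClosed_isBounded (isClosed_le continuous_const hφ) ?_)
    rw [← Metric.cobounded_eq_cocompact] at hlim
    have := hlim.eventually_lt_const (hcpos k)
    rw [Bornology.isBounded_def]
    filter_upwards [this] with x hx
    simpa using hx
  · intro x hx
    by_contra hxΩ
    have hx' : c k ≤ φ x := hx
    rw [hΩ x fun h => hxΩ (subset_closure h)] at hx'
    exact absurd hx' (hcpos k).not_ge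
  · intro x hx
    have hx' : φ x < c k := not_le.1 hx.2
    exact max_eq_right (by linarith)
  · simp only [hdiff, sobolevModular, lebesgueModular_eq, gagliardoModular_eq]
    exact hk

lemma exists_lipschitz_pos_iff_mem (hΩ : IsOpen Ω) : ∃ d : EuclideanSpace ℝ (Fin n) → ℝ,
    (∀ x y, |d x - d y| ≤ ‖x - y‖) ∧ (∀ x ∈ Ω, 0 < d x) ∧ ∀ x ∉ Ω, d x = 0 := by
  -- `infDist` to the empty set is `0`, so the case `Ω = univ` needs another function.
  rcases (Ωᶜ).eq_empty_or_nonempty with h | h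
  · have : Ω = Set.univ := Set.compl_empty_iff.1 h
    exact ⟨fun _ => 1, by simp, by simp, by simp [this]⟩
  · refine ⟨fun x => Metric.infDist x Ωᶜ, fun x y => ?_, fun x hx => ?_, fun x hx => ?_⟩
    · have := (Metric.lipschitz_infDist_pt Ωᶜ).dist_le_mul x y
      simpa [Real.dist_eq, dist_eq_norm] using this
    · exact (hΩ.isClosed_compl.notMem_iff_infDist_pos h).1 (by simpa using hx)
    · exact Metric.infDist_zero_of_mem hx

lemma abs_exp_neg_norm_sub_le (x y : EuclideanSpace ℝ (Fin n)) :
    |Real.exp (-‖x‖) - Real.exp (-‖y‖)| ≤ ‖x - y‖ := by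
  have key : ∀ a b : ℝ, 0 ≤ a → Real.exp (-a) - Real.exp (-b) ≤ |a - b| := by
    intro a b ha
    have h1 := Real.add_one_le_exp (-(b - a))
    have h2 : Real.exp (-b) = Real.exp (-a) * Real.exp (-(b - a)) := by
      rw [← Real.exp_add]; ring_nf
    have h3 : Real.exp (-a) ≤ 1 := Real.exp_le_one_iff.2 (by linarith)
    have h4 : Real.exp (-a) * (1 - |a - b|) ≤ Real.exp (-b) := by
      rw [h2]
      have := neg_abs_le (a - b)
      exact mul_le_mul_of_nonneg_left (by linarith) (Real.exp_pos _).le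
    nlinarith [abs_nonneg (a - b), Real.exp_pos (-a)]
  refine le_trans ?_ (abs_norm_sub_norm_le x y)
  rw [abs_sub_le_iff]
  exact ⟨key _ _ (norm_nonneg _), (key _ _ (norm_nonneg _)).trans (abs_sub_comm _ _).le⟩

/-- The function `min (dist(x, Ωᶜ)) (exp(-|x|))` lies in `W̃`, is positive on `Ω` and vanishes
off `Ω`; if `Ω` is the whole space, `1` takes the place of the distance. -/
lemma exists_memSobolevTilde_pos (hΩ : IsOpen Ω) (hs0 : 0 < s) (hs1 : s < 1)
    (hq : IsVariableExponent (volume.restrict Ω) q)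
    (hp : IsVariableExponent (volume.restrict (Ω ×ˢ Ω)) p) :
    ∃ φ : EuclideanSpace ℝ (Fin n) → ℝ, Continuous φ ∧ MemSobolevTilde Ω s q p φ ∧
      (∀ x ∈ Ω, φ x ≠ 0) ∧ ∀ x ∉ Ω, φ x = 0 := by
  obtain ⟨d, hd, hpos, hzero⟩ := exists_lipschitz_pos_iff_mem hΩ
  have hLip : ∀ x y, |min (d x) (Real.exp (-‖x‖)) - min (d y) (Real.exp (-‖y‖))| ≤ ‖x - y‖ :=
    fun x y => (abs_min_sub_min_le_max _ _ _ _).trans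
      (max_le (hd x y) (abs_exp_neg_norm_sub_le x y))
  have hcont : Continuous fun x => min (d x) (Real.exp (-‖x‖)) := by
    refine (LipschitzWith.of_dist_le_mul (K := 1) fun x y => ?_).continuous
    simpa [Real.dist_eq, dist_eq_norm] using hLip x y
  have h0 : ∀ x, 0 ≤ min (d x) (Real.exp (-‖x‖)) := by
    intro x
    refine le_min ?_ (Real.exp_pos _).le
    by_cases hx : x ∈ Ω
    · exact (hpos x hx).le
    · exact (hzero x hx).ge
  have hz : ∀ x ∉ Ω, min (d x) (Real.exp (-‖x‖)) = 0 := fun x hx => by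
    rw [hzero x hx, min_eq_left (Real.exp_pos _).le]
  have hlim : Tendsto (fun x : EuclideanSpace ℝ (Fin n) => min (d x) (Real.exp (-‖x‖)))
      (cocompact _) (𝓝 0) :=
    tendsto_of_tendsto_of_tendsto_of_le_of_le tendsto_const_nhds
      (Real.tendsto_exp_neg_atTop_nhds_zero.comp (tendsto_norm_cocompact_atTop)) h0
      fun x => min_le_right _ _
  exact ⟨_, hcont, memSobolevTilde_of_tendsto_cocompact hq hp hcont h0 hz hlim
    (memSobolev_of_lipschitz_of_exp_decay hs0 hs1 hq hp hLip h0 fun x => min_le_right _ _),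
    fun x hx => (lt_min (hpos x hx) (Real.exp_pos _)).ne', hz⟩

end

end FracVar

theorem mainTheorem2 {n : ℕ} (Ω : Set (EuclideanSpace ℝ (Fin n))) (hΩ : IsOpen Ω)
    (s : ℝ) (hs0 : 0 < s) (hs1 : s < 1)
    (q : EuclideanSpace ℝ (Fin n) → ℝ)
    (hq : FracVar.IsVariableExponent (volume.restrict Ω) q)
    (p : EuclideanSpace ℝ (Fin n) × EuclideanSpace ℝ (Fin n) → ℝ)
    (hp : FracVar.IsVariableExponent (volume.restrict (Ω ×ˢ Ω)) p)
    (N : Set (EuclideanSpace ℝ (Fin n))) (hN : N ⊆ Ω) :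
    FracVar.relCapacity Ω s q p (N ∩ Ω) = 0 ↔ FracVar.IsRemovable Ω s q p N := by
  obtain ⟨φ, hφ, hφT, hφpos, hφ0⟩ := FracVar.exists_memSobolevTilde_pos hΩ hs0 hs1 hq hp
  rw [Set.inter_eq_left.2 hN]
  exact ⟨FracVar.isRemovable_of_relCapacity_eq_zero hΩ.measurableSet hq hp,
    FracVar.relCapacity_eq_zero_of_isRemovable hΩ.measurableSet hq hp hN hφ hφT hφpos hφ0⟩
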